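/- Let $E=(E^0,E^1,s,r)$ be a finite directed graph with no sinks and no sources (every vertex is the source of some edge and the range of some edge). For $k\ge 0$ let $E^k$ be the set of paths $\alpha=e_1\cdots e_k$ of length $|\alpha|=k$ ($e_i\in E^1$, $s(e_j)=r(e_{j+1})$), with $r(\alpha)=r(e_1)$ and $s(\alpha)=s(e_k)$; paths of length $0$ are vertices. Let $A=c(E^0)$ be the $C^*$-algebra of functions on $E^0$, and let $X_{E^k}=c(E^k)$ be the $A$-correspondence with $(a\cdot\xi)(\alpha)=a(r(\alpha))\xi(\alpha)$, $(\xi\cdot a)(\alpha)=\xi(\alpha)a(s(\alpha))$ and $\langle\xi,\eta\rangle(v)=\sum_{s(\alpha)=v}\overline{\xi(\alpha)}\eta(\alpha)$; it is identified with $X_E^{\otimes k}$, where $X_E=X_{E^1}$ and $X_E^{\otimes 0}=A$. Let $\mathcal F=\bigoplus_{k\ge0}X_E^{\otimes k}$ be the Fock correspondence, $\mathcal L(\mathcal F)$ the $C^*$-algebra of its adjointable operators, $\mathcal K\subseteq\mathcal L(\mathcal F)$ the ideal of compact operators (the closed span of the maps $\theta_{\xi,\eta}:\zeta\mapsto\xi\langle\eta,\zeta\rangle$),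 and $q:\mathcal L(\mathcal F)\to\mathcal L(\mathcal F)/\mathcal K$ the quotient map. For $e\in E^1$ let $S_e\delta_\beta=\delta_{e\beta}$ if $r(\beta)=s(e)$ and $S_e\delta_\beta=0$ otherwise; for $v\in E^0$ let $P_v\delta_\beta=\delta_\beta$ if $r(\beta)=v$ and $P_v\delta_\beta=0$ otherwise. Put $u_e=q(S_e)$, $u_\alpha=u_{e_1}\cdots u_{e_k}$ for a path $\alpha=e_1\cdots e_k$ with $k\ge1$, and $u_v=q(P_v)$ for a vertex $v$. Let $Z=\{Z_k\}_{k\ge0}$ be a weight sequence: each $Z_k$ is a positive invertible adjointable operator on $X_E^{\otimes k}$ that commutes with the left action of $A$, $Z_0=I$, $\sup_k\|Z_k\|<\infty$, and there is $\varepsilon>0$ with $Z_k\ge\varepsilon I$ for all $k\ge1$. Put $z=q(\mathrm{diag}(Z_0,Z_1,\dots))$. Let $p\ge1$ and assume that $\lim_{k\to\infty}\|I_p\otimes Z_k-Z_{k+p}\|=0$, where $(I_p\otimes Z_k)\delta_{\beta\gamma}=\delta_\beta\otimes Z_k\delta_\gamma$ for $|\beta|=p$, $|\gamma|=k$. For $n\ge0$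 let $$\mathcal C_n=C^*\bigl(\{u_\alpha z^lu_\beta^*:\ l\ge0,\ np\le|\alpha|=|\beta|<(n+1)p,\ s(\alpha)=s(\beta)\}\bigr)\subseteq\mathcal L(\mathcal F)/\mathcal K .$$ For every $v\in E^0$ fix a path $\xi_v$ of length $p-1$ with $s(\xi_v)=v$, and let $\mathcal C_v=u_{\xi_v}u_{\xi_v}^*\,\mathcal C_0\,u_{\xi_v}u_{\xi_v}^*$. For $c\in\mathcal C_n$ let $$\tau_n(c)=\sum_{|\gamma_1|=|\gamma_2|=np+p-1,\ s(\gamma_1)=s(\gamma_2)}e_{\gamma_1,\gamma_2}\otimes u_{\xi_{s(\gamma_1)}}u_{\gamma_1}^*\,c\,u_{\gamma_2}u_{\xi_{s(\gamma_2)}}^* ,$$ where the $e_{\gamma_1,\gamma_2}$ are the matrix units indexed by $E^{np+p-1}$. For $e,f\in E^1$ with $r(e)=r(f)$ and $s(e)=s(f)$ let, for $c\in\mathcal C_{r(e)}$, $$\pi(e,f)(c)=u_{\xi_{s(e)}}u_e^*u_{\xi_{r(e)}}^*\,c\,u_{\xi_{r(f)}}u_fu_{\xi_{s(f)}}^* .$$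 Let $n\ge0$ and let $J$ be a two-sided ideal of $\mathcal C_n$ (not necessarily closed). Then there is a unique family $\{J_v\}_{v\in E^0}$ of subspaces (the corner ideals of $J$) such that 1. each $J_v$ is a two-sided ideal of $\mathcal C_v$; 2. $\tau_n(J)=\sum_{|\mu_1|=|\mu_2|=np+p-1,\ s(\mu_1)=s(\mu_2)}e_{\mu_1,\mu_2}\otimes J_{s(\mu_1)}$; 3. $J_v=u_{\xi_v}u_{\mu_1}^*\,J\,u_{\mu_2}u_{\xi_v}^*$ whenever $|\mu_1|=|\mu_2|=np+p-1$ and $s(\mu_1)=s(\mu_2)=v$; and $J$ is invariant, that is, $u_e^*Ju_f\subseteq J$ for all $e,f\in E^1$, if and only if $$\pi(e,f)(J_{r(e)})\subseteq J_{s(e)}\qquad\text{for all }e,f\in E^1\text{ with }r(e)=r(f)\text{ and }s(e)=s(f).$$ -/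

import Mathlib

open scoped ENNReal Topology

noncomputable section

namespace WeightedCK

/-- A directed graph with vertex set `V`, edge set `E`, source map `s` and range map `r`. -/
structure DirGraph (V E : Type*) where
  s : E → V
  r : E → V

namespace DirGraph

variable {V E : Type*} (G : DirGraph V E)

/-- No vertex is a sink: every vertex is the source of some edge. -/
def NoSinks : Prop := ∀ v, ∃ e, G.s e = v

/-- No vertex is a source: every vertex is the range of some edge. -/
def NoSources : Prop := ∀ v, ∃ e, G.r e = v

/-- `G.IsPath v [e₁, …, eₖ]` says that `r(e₁) = v` and `s(eⱼ) = r(eⱼ₊₁)` for `1 ≤ j < k`. -/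
def IsPath : V → List E → Prop
  | _, [] => True
  | v, e :: l => G.r e = v ∧ IsPath (G.s e) l

/-- The source of the path with range `v` and edges `l`: `s(eₖ)`, or `v` if there is no edge. -/
def endpoint : V → List E → V
  | v, [] => v
  | _, e :: l => endpoint (G.s e) l

theorem IsPath.take {v : V} {l : List E} (h : G.IsPath v l) (p : ℕ) : G.IsPath v (l.take p) := by
  induction l generalizing v p with
  | nil => simp [IsPath]
  | cons e l ih =>
    cases p with
    | zero => simp [IsPath]
    | succ p => exact ⟨h.1, ih h.2 p⟩

theorem IsPath.drop {v : V} {l : List E} (h : G.IsPath v l) (p : ℕ) :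
    G.IsPath (G.endpoint v (l.take p)) (l.drop p) := by
  induction l generalizing v p with
  | nil => simp [IsPath]
  | cons e l ih =>
    cases p with
    | zero => exact h
    | succ p => exact ih h.2 p

theorem IsPath.append {v : V} {l m : List E} (h : G.IsPath v l)
    (h' : G.IsPath (G.endpoint v l) m) : G.IsPath v (l ++ m) := by
  induction l generalizing v with
  | nil => exact h'
  | cons e l ih => exact ⟨h.1, ih h.2 h'⟩

/-- The set `E^k` of paths of length `k`, a path being given by its range and its list of edges
(so `E^0` is the set of vertices). -/
def Path (k : ℕ) : Type _ := {x : V × List E // G.IsPath x.1 x.2 ∧ x.2.length = k}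

namespace Path

variable {G} {k p : ℕ}

/-- The range `r(α)` of a path. -/
def rng (α : G.Path k) : V := α.1.1

/-- The list of edges of a path. -/
def edges (α : G.Path k) : List E := α.1.2

/-- The source `s(α)` of a path. -/
def src (α : G.Path k) : V := G.endpoint α.1.1 α.1.2

instance [Finite V] [Finite E] : Finite (G.Path k) := by
  have : Finite {l : List E // l.length = k} := (List.finite_length_eq E k).to_subtype
  refine Finite.of_injective
    (fun α : G.Path k => ((α.1.1, ⟨α.1.2, α.2.2⟩) : V × {l : List E // l.length = k})) ?_
  intro α β h
  simp only [Prod.mk.injEq, Subtype.mk.injEq] at h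
  exact Subtype.ext (Prod.ext h.1 h.2)

instance [Fintype V] [Fintype E] : Fintype (G.Path k) := Fintype.ofFinite _

/-- The first edge of a path of positive length. -/
def head (α : G.Path (k + 1)) : E :=
  α.1.2.head (List.ne_nil_of_length_pos (by rw [α.2.2]; exact k.succ_pos))

/-- The path `β` with `α = e β`, where `e` is the first edge of `α`. -/
def tail (α : G.Path (k + 1)) : G.Path k :=
  ⟨(G.s α.head, α.1.2.tail), by
    obtain ⟨⟨v, l⟩, h, hl⟩ := α
    cases l with
    | nil => simp at hl
    | cons e l => exact ⟨h.2, by simpa using hl⟩⟩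

/-- For `α = βγ` with `|β| = p` and `|γ| = k`, the path `β`. -/
def initial (α : G.Path (p + k)) : G.Path p :=
  ⟨(α.1.1, α.1.2.take p), IsPath.take G α.2.1 p, by simp [α.2.2]⟩

/-- For `α = βγ` with `|β| = p` and `|γ| = k`, the path `γ`. -/
def final (α : G.Path (p + k)) : G.Path k :=
  ⟨(G.endpoint α.1.1 (α.1.2.take p), α.1.2.drop p), IsPath.drop G α.2.1 p, by simp [α.2.2]⟩

/-- The path `βγ`, for `s(β) = r(γ)`. -/
def append (β : G.Path p) (γ : G.Path k) (h : β.src = γ.rng) : G.Path (p + k) :=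
  ⟨(β.1.1, β.1.2 ++ γ.1.2), IsPath.append G β.2.1 (by
    have h1 : G.endpoint β.1.1 β.1.2 = γ.1.1 := h
    rw [h1]; exact γ.2.1), by simp [β.2.2, γ.2.2]⟩

theorem src_tail (α : G.Path (k + 1)) : α.tail.src = α.src := by
  obtain ⟨⟨v, l⟩, h, hl⟩ := α
  cases l with
  | nil => simp at hl
  | cons e l => rfl

theorem head_tail_injective {α β : G.Path (k + 1)} (h : α.head = β.head)
    (h' : α.tail = β.tail) : α = β := by
  obtain ⟨⟨v, l⟩, h1, hl⟩ := α
  obtain ⟨⟨w, m⟩, h2, hm⟩ := β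
  cases l with
  | nil => simp at hl
  | cons e l =>
    cases m with
    | nil => simp at hm
    | cons f m =>
      have he : e = f := h
      have hlm : l = m := congrArg (fun x : G.Path k => x.1.2) h'
      subst he; subst hlm
      have : v = w := h1.1.symm.trans h2.1
      subst this; rfl

end Path

end DirGraph

variable {V E : Type*} [Fintype V] [Fintype E] (G : DirGraph V E)

/-! ### The correspondences `X_E^{⊗k}` and the Fock correspondence over `A = c(E^0) = (V → ℂ)`

`X_E^{⊗k}` is identified with `X_{E^k}`, the functions on `E^k`. Its `A`-valued inner product and
its right action only differ from a Hilbert space structure by being recorded source by source.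
Since `V` is finite, the norm of the Hilbert `A`-module (the maximum over `v ∈ E^0` of the `ℓ²`-norms
of the restrictions to `{α : s(α) = v}`) is equivalent to the `ℓ²`-norm, and the two operator norms
agree on adjointable operators, because these are the operators that preserve that decomposition. -/

/-- `X_E^{⊗k} = X_{E^k}`. -/
abbrev X (k : ℕ) : Type _ := EuclideanSpace ℂ (G.Path k)

/-- The Fock correspondence `⊕_{k ≥ 0} X_E^{⊗k}`. -/
abbrev Fock : Type _ := lp (fun k : ℕ => X G k) 2

open Classical in
/-- The `A`-valued inner product of `X_E^{⊗k}`: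
`⟨ξ, η⟩(v) = ∑_{s(α) = v} conj ξ(α) η(α)`. -/
def innerX {k : ℕ} (ξ η : X G k) : V → ℂ := fun v =>
  ∑ α : G.Path k, if α.src = v then star (ξ α) * η α else 0

/-- The `A`-valued inner product of the Fock correspondence. -/
def innerA (ξ η : Fock G) : V → ℂ := fun v => ∑' k, innerX G (ξ k) (η k) v

/-- The bounded operator `T` on `X_E^{⊗k}` is adjointable for the `A`-valued inner product.
(The adjoint, if there is one, is the Hilbert space adjoint: sum over `v`.) -/
def IsAdjointableX {k : ℕ} (T : X G k →L[ℂ] X G k) : Prop :=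
  ∀ ξ η, innerX G (T ξ) η = innerX G ξ (ContinuousLinearMap.adjoint T η)

/-- Pointwise multiplication by a function `g` on `E^k`. -/
def mulX {k : ℕ} (g : G.Path k → ℂ) : X G k →L[ℂ] X G k :=
  LinearMap.toContinuousLinearMap
    { toFun := fun ξ => WithLp.toLp 2 fun α => g α * ξ α
      map_add' := fun ξ η => by ext α; simp [mul_add]
      map_smul' := fun c ξ => by ext α; simp; ring }

/-- The left action of `a ∈ A` on `X_E^{⊗k}`: `(a·ξ)(α) = a(r(α)) ξ(α)`. -/
def leftX (k : ℕ) (a : V → ℂ) : X G k →L[ℂ] X G k := mulX G fun α => a α.rng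

/-- The right action of `a ∈ A` on `X_E^{⊗k}`: `(ξ·a)(α) = ξ(α) a(s(α))`. -/
def rightX (k : ℕ) (a : V → ℂ) : X G k →L[ℂ] X G k := mulX G fun α => a α.src

theorem mulX_apply {k : ℕ} (g : G.Path k → ℂ) (ξ : X G k) (α : G.Path k) :
    mulX G g ξ α = g α * ξ α := rfl

theorem norm_mulX_le {k : ℕ} {g : G.Path k → ℂ} {C : ℝ} (hC : 0 ≤ C) (hg : ∀ α, ‖g α‖ ≤ C) :
    ‖mulX G g‖ ≤ C := by
  refine ContinuousLinearMap.opNorm_le_bound _ hC fun ξ => ?_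
  rw [EuclideanSpace.norm_eq, EuclideanSpace.norm_eq]
  refine Real.sqrt_le_iff.2 ⟨by positivity, ?_⟩
  rw [mul_pow, Real.sq_sqrt (by positivity), Finset.mul_sum]
  refine Finset.sum_le_sum fun α _ => ?_
  rw [mulX_apply, norm_mul, mul_pow]
  gcongr
  exact hg α

/-- The operator `diag(T_0, T_1, …)` on the Fock correspondence, for a bounded sequence `T`. -/
def diag (T : ∀ k, X G k →L[ℂ] X G k) (hT : ∃ C, ∀ k, ‖T k‖ ≤ C) : Fock G →L[ℂ] Fock G :=
  have hC : ∀ k, ‖T k‖ ≤ max hT.choose 0 := fun k => (hT.choose_spec k).trans (le_max_left _ _)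
  have hb : ∀ (ξ : Fock G) k, ‖T k (ξ k)‖ ≤ ‖(((max hT.choose 0 : ℝ) : ℂ) • ξ : Fock G) k‖ :=
    fun ξ k => by
      rw [lp.coeFn_smul, Pi.smul_apply, norm_smul, Complex.norm_real, Real.norm_of_nonneg
        (le_max_right _ _)]
      exact (T k).le_of_opNorm_le (hC k) _
  LinearMap.mkContinuous
    { toFun := fun ξ => ⟨fun k => T k (ξ k), (lp.memℓp _).mono' (hb ξ)⟩
      map_add' := fun ξ η => by
        apply lp.ext; funext k
        exact map_add (T k) (ξ k) (η k)
      map_smul' := fun c ξ => by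
        apply lp.ext; funext k
        exact map_smul (T k) c (ξ k) }
    (max hT.choose 0) fun ξ => by
      refine (lp.norm_mono (by norm_num) (hb ξ)).trans ?_
      rw [norm_smul, Complex.norm_real, Real.norm_of_nonneg (le_max_right _ _)]

theorem diag_apply (T : ∀ k, X G k →L[ℂ] X G k) (hT : ∃ C, ∀ k, ‖T k‖ ≤ C) (ξ : Fock G) (k : ℕ) :
    diag G T hT ξ k = T k (ξ k) := rfl

theorem actions_bounded {f : ∀ k, G.Path k → V} (a : V → ℂ) :
    ∃ C, ∀ k, ‖mulX G (fun α : G.Path k => a (f k α))‖ ≤ C :=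
  ⟨‖a‖, fun _ => norm_mulX_le G (norm_nonneg _) fun _ => norm_le_pi_norm a _⟩

/-- The left action `φ_∞(a)` of `a ∈ A` on the Fock correspondence. -/
def leftFock (a : V → ℂ) : Fock G →L[ℂ] Fock G :=
  diag G (fun k => leftX G k a) (actions_bounded G (f := fun _ α => α.rng) a)

/-- The right action `ξ ↦ ξ·a` of `a ∈ A` on the Fock correspondence. -/
def rightFock (a : V → ℂ) : Fock G →L[ℂ] Fock G :=
  diag G (fun k => rightX G k a) (actions_bounded G (f := fun _ α => α.src) a)

open Classical in
theorem innerX_eq {k : ℕ} (ξ η : X G k) (v : V) :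
    innerX G ξ η v = inner ℂ ξ (rightX G k (Pi.single v 1) η) := by
  rw [PiLp.inner_apply, innerX]
  refine Finset.sum_congr rfl fun α _ => ?_
  rw [rightX, mulX_apply]
  by_cases h : α.src = v
  · subst h; simp [mul_comm]
  · simp [h]

open Classical in
theorem innerA_eq (ξ η : Fock G) (v : V) :
    innerA G ξ η v = inner ℂ ξ (rightFock G (Pi.single v 1) η) := by
  rw [lp.inner_eq_tsum, innerA]
  exact tsum_congr fun k => innerX_eq G _ _ _

/-! ### The `C^*`-algebra `𝓛(𝓕(X_E))` of adjointable operators -/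

theorem innerA_add_left (ξ ξ' η : Fock G) :
    innerA G (ξ + ξ') η = innerA G ξ η + innerA G ξ' η := by
  funext v; simp only [innerA_eq, inner_add_left, Pi.add_apply]

theorem innerA_add_right (ξ η η' : Fock G) :
    innerA G ξ (η + η') = innerA G ξ η + innerA G ξ η' := by
  funext v; simp only [innerA_eq, inner_add_right, Pi.add_apply, map_add]

theorem innerA_smul_right (c : ℂ) (ξ η : Fock G) :
    innerA G ξ (c • η) = c • innerA G ξ η := by
  funext v; simp only [innerA_eq, inner_smul_right, Pi.smul_apply, map_smul, smul_eq_mul]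

theorem innerA_smul_left (c : ℂ) (ξ η : Fock G) :
    innerA G (c • ξ) η = star c • innerA G ξ η := by
  funext v; simp only [innerA_eq, inner_smul_left, Pi.smul_apply, smul_eq_mul]; rfl

theorem innerX_star {k : ℕ} (ξ η : X G k) (v : V) :
    star (innerX G ξ η v) = innerX G η ξ v := by
  simp only [innerX, star_sum]
  refine Finset.sum_congr rfl fun α _ => ?_
  split_ifs <;> simp [mul_comm]

theorem innerA_star (ξ η : Fock G) : star (innerA G ξ η) = innerA G η ξ := by
  funext v
  simp only [innerA, Pi.star_apply]
  rw [tsum_star]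
  exact tsum_congr fun k => innerX_star G _ _ _

/-- The algebra `𝓛(𝓕(X_E))` of operators on the Fock correspondence that are adjointable for
its `A`-valued inner product. -/
def L : StarSubalgebra ℂ (Fock G →L[ℂ] Fock G) where
  carrier := {T | ∀ ξ η, innerA G (T ξ) η = innerA G ξ (ContinuousLinearMap.adjoint T η)}
  mul_mem' := by
    intro S T hS hT ξ η
    rw [← ContinuousLinearMap.star_eq_adjoint, star_mul]
    exact (hS _ _).trans (hT _ _)
  add_mem' := by
    intro S T hS hT ξ η
    rw [map_add]
    change innerA G (S ξ + T ξ) η = innerA G ξ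
      (ContinuousLinearMap.adjoint S η + ContinuousLinearMap.adjoint T η)
    rw [innerA_add_left, innerA_add_right, hS, hT]
  algebraMap_mem' := by
    intro c ξ η
    rw [← ContinuousLinearMap.star_eq_adjoint, ← algebraMap_star_comm]
    simp only [Algebra.algebraMap_eq_smul_one]
    change innerA G (c • ξ) η = innerA G ξ (star c • η)
    rw [innerA_smul_left, innerA_smul_right]
  star_mem' := by
    intro T hT ξ η
    rw [ContinuousLinearMap.star_eq_adjoint, ContinuousLinearMap.adjoint_adjoint]
    rw [← innerA_star, ← hT, innerA_star]

theorem rightFock_apply (a : V → ℂ) (ξ : Fock G) (k : ℕ) (α : G.Path k) :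
    rightFock G a ξ k α = a α.src * ξ k α := rfl

theorem inner_rightX (k : ℕ) (a : V → ℂ) (ξ η : X G k) :
    inner ℂ (rightX G k a ξ) η = inner ℂ ξ (rightX G k (star a) η) := by
  rw [PiLp.inner_apply, PiLp.inner_apply]
  refine Finset.sum_congr rfl fun α _ => ?_
  simp [rightX, mulX_apply]; ring

theorem inner_rightFock (a : V → ℂ) (ξ η : Fock G) :
    inner ℂ (rightFock G a ξ) η = inner ℂ ξ (rightFock G (star a) η) := by
  rw [lp.inner_eq_tsum, lp.inner_eq_tsum]
  exact tsum_congr fun k => inner_rightX G k a _ _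

/-- Bounded operators that commute with the right action are adjointable. -/
theorem mem_L_of_commute {T : Fock G →L[ℂ] Fock G}
    (hT : ∀ a ξ, T (rightFock G a ξ) = rightFock G a (T ξ)) : T ∈ L G := by
  classical
  intro ξ η
  funext v
  rw [innerA_eq, innerA_eq]
  have h : ContinuousLinearMap.adjoint T (rightFock G (Pi.single v 1) η) =
      rightFock G (Pi.single v 1) (ContinuousLinearMap.adjoint T η) := by
    refine ext_inner_left ℂ fun ζ => ?_
    have hs : star (Pi.single v 1 : V → ℂ) = Pi.single v 1 := by
      rw [← Pi.single_star, star_one]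
    rw [ContinuousLinearMap.adjoint_inner_right, ← hs, ← inner_rightFock, ← hT, ← inner_rightFock,
      ContinuousLinearMap.adjoint_inner_right]
  rw [← h, ContinuousLinearMap.adjoint_inner_right]

theorem sum_innerA (ξ η : Fock G) : ∑ v, innerA G ξ η v = inner ℂ ξ η := by
  classical
  simp only [innerA_eq, ← inner_sum]
  congr 1
  apply lp.ext; funext k
  rw [lp.coeFn_sum, Finset.sum_apply]
  ext α
  rw [WithLp.ofLp_sum, Finset.sum_apply]
  simp only [rightFock_apply]
  rw [Finset.sum_eq_single α.src]
  · simp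
  · intro v _ hv; simp [hv.symm]
  · simp

theorem innerA_rightFock (b : V → ℂ) (ζ η : Fock G) (v : V) :
    innerA G ζ (rightFock G b η) v = b v * innerA G ζ η v := by
  classical
  rw [innerA_eq, innerA_eq, ← inner_smul_right]
  congr 1
  apply lp.ext; funext k; ext α
  rw [lp.coeFn_smul]
  change _ = b v * (rightFock G (Pi.single v 1) η k α)
  rw [rightFock_apply, rightFock_apply, rightFock_apply]
  by_cases h : α.src = v
  · subst h; ring
  · simp [h]

/-- Adjointable operators are module maps. -/
theorem commute_of_mem_L {T : Fock G →L[ℂ] Fock G} (hT : T ∈ L G) (a : V → ℂ) (ξ : Fock G) :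
    T (rightFock G a ξ) = rightFock G a (T ξ) := by
  classical
  refine ext_inner_left ℂ fun η => ?_
  rw [← ContinuousLinearMap.adjoint_inner_left, ← sum_innerA, ← sum_innerA]
  refine Finset.sum_congr rfl fun v _ => ?_
  have h2 : star T ∈ L G := star_mem hT
  have h3 := congrFun (h2 η ξ) v
  rw [ContinuousLinearMap.star_eq_adjoint, ContinuousLinearMap.adjoint_adjoint] at h3
  rw [innerA_rightFock, innerA_rightFock, ← h3]

/-! ### Compact operators and the quotient `𝓛(𝓕(X_E)) / 𝓚` -/

/-- `T` is the operator `θ_{ξ,η} : ζ ↦ ξ·⟨η, ζ⟩` for some `ξ, η`. -/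
def IsTheta (T : L G) : Prop :=
  ∃ ξ η : Fock G, ∀ ζ : Fock G, T.1 ζ = rightFock G (innerA G η ζ) ξ

theorem IsTheta.mul_left {T : L G} (h : IsTheta G T) (S : L G) : IsTheta G (S * T) := by
  obtain ⟨ξ, η, h⟩ := h
  refine ⟨S.1 ξ, η, fun ζ => ?_⟩
  change S.1 (T.1 ζ) = _
  rw [h, commute_of_mem_L G S.2]

theorem IsTheta.mul_right {T : L G} (h : IsTheta G T) (S : L G) : IsTheta G (T * S) := by
  obtain ⟨ξ, η, h⟩ := h
  refine ⟨ξ, ContinuousLinearMap.adjoint S.1 η, fun ζ => ?_⟩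
  change T.1 (S.1 ζ) = _
  rw [h, ← innerA_star, S.2, innerA_star]

theorem IsTheta.star {T : L G} (h : IsTheta G T) : IsTheta G (star T) := by
  classical
  obtain ⟨ξ, η, h⟩ := h
  refine ⟨η, ξ, fun ζ => ?_⟩
  have key : ∀ (a : V → ℂ) (x y : Fock G),
      inner ℂ x (rightFock G a y) = ∑ v, a v * innerA G x y v := by
    intro a x y
    rw [← sum_innerA]
    exact Finset.sum_congr rfl fun v _ => innerA_rightFock G a x y v
  refine ext_inner_left ℂ fun x => ?_
  change inner ℂ x (ContinuousLinearMap.adjoint T.1 ζ) = _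
  rw [ContinuousLinearMap.adjoint_inner_right, h, inner_rightFock, key, key]
  refine Finset.sum_congr rfl fun v _ => ?_
  rw [innerA_star, mul_comm]

/-- The linear span of the operators `θ_{ξ,η}`. -/
def thetaSpan : Submodule ℂ (L G) := Submodule.span ℂ {T | IsTheta G T}

/-- The ideal `𝓚 = 𝓚(𝓕(X_E))` of (generalized) compact operators: the closed linear span of
the operators `θ_{ξ,η}`. -/
def K : Ideal (L G) where
  carrier := closure (thetaSpan G : Set (L G))
  add_mem' := fun ha hb => (thetaSpan G).toAddSubmonoid.topologicalClosure.add_mem ha hb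
  zero_mem' := subset_closure (thetaSpan G).zero_mem
  smul_mem' := by
    intro S T hT
    refine map_mem_closure (f := fun T => S * T) (continuous_const.mul continuous_id) hT ?_
    intro T hT
    refine Submodule.span_induction ?_ ?_ ?_ ?_ hT
    · exact fun T hT => Submodule.subset_span (IsTheta.mul_left G hT S)
    · simp
    · intro x y _ _ hx hy
      simpa [mul_add] using (thetaSpan G).add_mem hx hy
    · intro c x _ hx
      simpa [mul_smul_comm] using (thetaSpan G).smul_mem c hx

instance : (K G).IsTwoSided where
  mul_mem_of_left := by
    intro T S hT
    refine map_mem_closure (f := fun T => T * S) (continuous_id.mul continuous_const) hT ?_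
    intro T hT
    refine Submodule.span_induction ?_ ?_ ?_ ?_ hT
    · exact fun T hT => Submodule.subset_span (IsTheta.mul_right G hT S)
    · simp
    · intro x y _ _ hx hy
      simpa [add_mul] using (thetaSpan G).add_mem hx hy
    · intro c x _ hx
      simpa [smul_mul_assoc] using (thetaSpan G).smul_mem c hx

theorem star_mem_K {T : L G} (hT : T ∈ K G) : star T ∈ K G := by
  refine map_mem_closure (f := fun T : L G => star T) continuous_star hT ?_
  intro T hT
  refine Submodule.span_induction ?_ ?_ ?_ ?_ hT
  · exact fun T hT => Submodule.subset_span (IsTheta.star G hT)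
  · simp
  · intro x y _ _ hx hy
    simpa using (thetaSpan G).add_mem hx hy
  · intro c x _ hx
    simpa using (thetaSpan G).smul_mem (star c) hx

/-- The quotient algebra `𝓛(𝓕(X_E)) / 𝓚`, with the quotient norm. -/
def LK : Type _ := L G ⧸ K G

instance : Ring (LK G) := inferInstanceAs (Ring (L G ⧸ K G))

instance : Algebra ℂ (LK G) := inferInstanceAs (Algebra ℂ (L G ⧸ K G))

/-- The topology of the quotient norm. -/
instance : TopologicalSpace (LK G) :=
  (Submodule.Quotient.seminormedAddCommGroup (K G)).toUniformSpace.toTopologicalSpace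

/-- The quotient map `q`. -/
def q : L G →+* LK G := Ideal.Quotient.mk (K G)

instance : Star (LK G) where
  star := Quotient.lift (fun T => q G (star T)) fun S T h => by
    have h' : S - T ∈ K G := (Submodule.quotientRel_def _).1 h
    refine Ideal.Quotient.eq.2 ?_
    rw [← star_sub]
    exact star_mem_K G h'

theorem star_q (T : L G) : star (q G T) = q G (star T) := rfl

theorem q_surjective : Function.Surjective (q G) := Ideal.Quotient.mk_surjective

instance : StarRing (LK G) where
  star_involutive := fun x => by
    obtain ⟨T, rfl⟩ := q_surjective G x
    rw [star_q, star_q, star_star]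
  star_mul := fun x y => by
    obtain ⟨S, rfl⟩ := q_surjective G x
    obtain ⟨T, rfl⟩ := q_surjective G y
    rw [← map_mul, star_q, star_q, star_q, star_mul, map_mul]
  star_add := fun x y => by
    obtain ⟨S, rfl⟩ := q_surjective G x
    obtain ⟨T, rfl⟩ := q_surjective G y
    rw [← map_add, star_q, star_q, star_q, star_add, map_add]

theorem q_smul (c : ℂ) (T : L G) : q G (c • T) = c • q G T := rfl

instance : StarModule ℂ (LK G) where
  star_smul := fun c x => by
    obtain ⟨T, rfl⟩ := q_surjective G x
    rw [← q_smul, star_q, star_q, star_smul, q_smul]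

/-- The `C^*`-subalgebra `C^*(M)` of `𝓛(𝓕(X_E)) / 𝓚` generated by a subset `M`: the smallest
norm closed `*`-subalgebra that contains `M`. -/
def generatedCStar (M : Set (LK G)) : NonUnitalStarSubalgebra ℂ (LK G) :=
  sInf {S | IsClosed (S : Set (LK G)) ∧ M ⊆ S}

/-! ### Creation operators, weights, and their images in the quotient -/

open Classical in
/-- The map `δ_e ⊗ · : X_E^{⊗k} → X_E^{⊗(k+1)}`, sending `δ_β` to `δ_{eβ}` if `r(β) = s(e)` and
to `0` otherwise. -/
def createX (e : E) (k : ℕ) : X G k →ₗ[ℂ] X G (k + 1) where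
  toFun ξ := WithLp.toLp 2 fun α => if α.head = e then ξ α.tail else 0
  map_add' ξ η := by ext α; by_cases h : α.head = e <;> simp [h]
  map_smul' c ξ := by ext α; by_cases h : α.head = e <;> simp [h]

theorem norm_createX_le (e : E) (k : ℕ) (ξ : X G k) : ‖createX G e k ξ‖ ≤ ‖ξ‖ := by
  classical
  rw [EuclideanSpace.norm_eq, EuclideanSpace.norm_eq]
  refine Real.sqrt_le_sqrt ?_
  have h1 : ∀ α : G.Path (k + 1), ‖createX G e k ξ α‖ ^ 2 =
      if α.head = e then ‖ξ α.tail‖ ^ 2 else 0 := by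
    intro α
    change ‖if α.head = e then ξ α.tail else 0‖ ^ 2 = _
    split_ifs <;> simp
  simp only [h1]
  rw [← Finset.sum_filter]
  rw [← Finset.sum_image (s := Finset.univ.filter fun α : G.Path (k + 1) => α.head = e)
    (g := DirGraph.Path.tail) (f := fun β => ‖ξ β‖ ^ 2)]
  · exact Finset.sum_le_univ_sum_of_nonneg fun β => by positivity
  · intro α hα β hβ h
    simp only [Finset.coe_filter, Finset.mem_univ, true_and, Set.mem_ofPred_eq] at hα hβ
    exact DirGraph.Path.head_tail_injective (hα.trans hβ.symm) h

/-- The sequence of components of `δ_e ⊗ ξ`. -/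
def createSeq (e : E) (ξ : Fock G) : ∀ k, X G k
  | 0 => 0
  | k + 1 => createX G e k (ξ k)

theorem createSeq_summable (e : E) (ξ : Fock G) :
    Summable (fun k => ‖createSeq G e ξ k‖ ^ (2 : ℝ≥0∞).toReal) ∧
    ∑' k, ‖createSeq G e ξ k‖ ^ (2 : ℝ≥0∞).toReal ≤ ‖ξ‖ ^ (2 : ℝ≥0∞).toReal := by
  have hp : 0 < (2 : ℝ≥0∞).toReal := by norm_num
  have hle : ∀ k, ‖createSeq G e ξ (k + 1)‖ ^ (2 : ℝ≥0∞).toReal ≤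
      ‖ξ k‖ ^ (2 : ℝ≥0∞).toReal := fun k =>
    Real.rpow_le_rpow (norm_nonneg _) (norm_createX_le G e k (ξ k)) hp.le
  have hs := lp.hasSum_norm hp ξ
  have h1 : Summable fun k => ‖createSeq G e ξ (k + 1)‖ ^ (2 : ℝ≥0∞).toReal :=
    Summable.of_nonneg_of_le (fun k => by positivity) hle hs.summable
  have h2 := (summable_nat_add_iff
    (f := fun k => ‖createSeq G e ξ k‖ ^ (2 : ℝ≥0∞).toReal) 1).1 h1
  refine ⟨h2, ?_⟩
  rw [h2.tsum_eq_zero_add]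
  have h0 : ‖createSeq G e ξ 0‖ ^ (2 : ℝ≥0∞).toReal = 0 := by
    simp [createSeq]
  rw [h0, zero_add, ← hs.tsum_eq]
  exact h1.tsum_le_tsum hle hs.summable

/-- The creation operator `S_e` as a bounded operator: `S_e ξ = δ_e ⊗ ξ`. -/
def createFock (e : E) : Fock G →L[ℂ] Fock G :=
  LinearMap.mkContinuous
    { toFun := fun ξ => ⟨createSeq G e ξ, memℓp_gen (createSeq_summable G e ξ).1⟩
      map_add' := fun ξ η => by
        apply lp.ext; funext k
        cases k with
        | zero => exact (add_zero (0 : X G 0)).symm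
        | succ k => exact map_add (createX G e k) (ξ k) (η k)
      map_smul' := fun c ξ => by
        apply lp.ext; funext k
        cases k with
        | zero => exact (smul_zero c : c • (0 : X G 0) = 0).symm
        | succ k => exact map_smul (createX G e k) c (ξ k) }
    1 fun ξ => by
      rw [one_mul]
      exact lp.norm_le_of_tsum_le (by norm_num) (norm_nonneg _) (createSeq_summable G e ξ).2

open Classical in
/-- The creation operator `S_e ∈ 𝓛(𝓕(X_E))`. -/
def S (e : E) : L G := ⟨createFock G e, mem_L_of_commute G fun a ξ => by
  apply lp.ext; funext k
  cases k with
  | zero => exact (map_zero (rightX G 0 a)).symm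
  | succ k =>
    ext α
    change (if α.head = e then a α.tail.src * ξ k α.tail else 0) =
      a α.src * (if α.head = e then ξ k α.tail else 0)
    rw [DirGraph.Path.src_tail]
    split_ifs <;> simp⟩

open Classical in
/-- The projection `P_v = φ_∞(δ_v) ∈ 𝓛(𝓕(X_E))`. -/
def P (v : V) : L G := ⟨leftFock G (Pi.single v 1), mem_L_of_commute G fun a ξ => by
  apply lp.ext; funext k; ext α
  change _ * (_ * _) = _ * (_ * _)
  ring⟩

/-- A weight sequence: operators `Z_k ∈ 𝓛(X_E^{⊗k}) ∩ φ(A)'`, positive and invertible, with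
`Z_0 = I`, `sup ‖Z_k‖ < ∞` and `Z_k ≥ ε I` for all `k ≥ 1`, for some `ε > 0`. -/
structure WeightSequence where
  Z : ∀ k, X G k →L[ℂ] X G k
  adjointable : ∀ k, IsAdjointableX G (Z k)
  commute_left : ∀ k a, Z k * leftX G k a = leftX G k a * Z k
  zero : Z 0 = 1
  bounded : ∃ C, ∀ k, ‖Z k‖ ≤ C
  positive : ∀ k, (Z k).IsPositive
  invertible : ∀ k, IsUnit (Z k)
  bounded_below : ∃ ε : ℝ, 0 < ε ∧ ∀ k, 1 ≤ k → (Z k - (ε : ℂ) • 1).IsPositive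

open Classical in
/-- For `β ∈ E^p`, the map `X_E^{⊗(p+k)} → X_E^{⊗k}`, `ξ ↦ (γ ↦ ξ(βγ))`, with value `0` at `γ`
when `βγ` is not a path. -/
def sliceX {p : ℕ} (k : ℕ) (β : G.Path p) : X G (p + k) →ₗ[ℂ] X G k where
  toFun ξ := WithLp.toLp 2 fun γ => if h : β.src = γ.rng then ξ (β.append γ h) else 0
  map_add' ξ η := by ext γ; by_cases h : β.src = γ.rng <;> simp [h]
  map_smul' c ξ := by ext γ; by_cases h : β.src = γ.rng <;> simp [h]

/-- The operator `I_p ⊗ T` on `X_E^{⊗(p+k)}`, for `T` in `𝓛(X_E^{⊗k}) ∩ φ(A)'`: it sends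
`δ_β ⊗ η` to `δ_β ⊗ T η`. In coordinates, `((I_p ⊗ T) ξ)(βγ) = (T (ξ(β ·)))(γ)`. -/
def idTensor (p : ℕ) {k : ℕ} (T : X G k →L[ℂ] X G k) : X G (p + k) →L[ℂ] X G (p + k) :=
  LinearMap.toContinuousLinearMap
    { toFun := fun ξ => WithLp.toLp 2 fun α => T (sliceX G k α.initial ξ) α.final
      map_add' := fun ξ η => by ext α; simp
      map_smul' := fun c ξ => by ext α; simp }

variable {G}

/-- Condition A(p): `‖I_p ⊗ Z_k - Z_{k+p}‖ → 0` as `k → ∞`. -/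
def ConditionA (W : WeightSequence G) (p : ℕ) : Prop :=
  Filter.Tendsto (fun k => ‖idTensor G p (W.Z k) - W.Z (p + k)‖) Filter.atTop (𝓝 0)

theorem commute_rightX {k : ℕ} {T : X G k →L[ℂ] X G k} (hT : IsAdjointableX G T) (a : V → ℂ)
    (ξ : X G k) : T (rightX G k a ξ) = rightX G k a (T ξ) := by
  classical
  have key : ∀ (b : V → ℂ) (ζ η : X G k),
      inner ℂ ζ (rightX G k b η) = ∑ v, b v * innerX G ζ η v := by
    intro b ζ η
    simp only [innerX_eq]
    rw [Finset.sum_congr rfl fun v _ => (inner_smul_right (𝕜 := ℂ) ζ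
      (rightX G k (Pi.single v 1) η) (b v)).symm, ← inner_sum]
    congr 1
    ext α
    rw [WithLp.ofLp_sum, Finset.sum_apply, Finset.sum_eq_single α.src]
    · simp [rightX, mulX_apply]
    · intro v _ hv; simp [rightX, mulX_apply, Pi.single_apply, hv.symm]
    · simp
  refine ext_inner_left ℂ fun η => ?_
  rw [← ContinuousLinearMap.adjoint_inner_left, key, key]
  refine Finset.sum_congr rfl fun v _ => ?_
  rw [← innerX_star, ← congrFun (hT ξ η) v, innerX_star]

/-- The weight operator `Z = diag(Z_0, Z_1, …) ∈ 𝓛(𝓕(X_E))`. -/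
def WeightSequence.op (W : WeightSequence G) : L G :=
  ⟨diag G W.Z W.bounded, mem_L_of_commute G fun a ξ => by
    apply lp.ext; funext k
    exact commute_rightX (W.adjointable k) a (ξ k)⟩

/-- `z = q(Z)`. -/
def WeightSequence.z (W : WeightSequence G) : LK G := q G W.op

variable (G) in
/-- `u_e = q(S_e)` for an edge `e`. -/
def u (e : E) : LK G := q G (S G e)

/-- `u_α = u_{e₁} ⋯ u_{eₖ}` for a path `α = e₁ ⋯ eₖ`; for a path of length `0`, that is, a vertex
`v`, it is `p_v = q(P_v)`. -/
def uPath {k : ℕ} (α : G.Path k) : LK G :=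
  match α.edges with
  | [] => q G (P G α.rng)
  | e :: l => ((e :: l).map (u G)).prod

/-- `C_n = C^*({u_α z^l u_β^* : l ≥ 0, np ≤ |α| = |β| < (n+1)p, s(α) = s(β)})`. -/
def C (W : WeightSequence G) (p n : ℕ) : NonUnitalStarSubalgebra ℂ (LK G) :=
  generatedCStar G {x | ∃ (l k : ℕ) (α β : G.Path k), n * p ≤ k ∧ k < (n + 1) * p ∧
    α.src = β.src ∧ x = uPath α * W.z ^ l * star (uPath β)}

/-- `C_v = u_{ξ_v} u_{ξ_v}^* C_0 u_{ξ_v} u_{ξ_v}^*`, for the chosen paths `ξ_v` of length `p - 1`. -/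
def Cv (W : WeightSequence G) (p : ℕ) (ξ : V → G.Path (p - 1)) (v : V) : Set (LK G) :=
  {x | ∃ c ∈ C W p 0,
    x = uPath (ξ v) * star (uPath (ξ v)) * c * (uPath (ξ v) * star (uPath (ξ v)))}

/-- The subspace `J` is a two-sided ideal of the algebra `B`. -/
def IsIdealOf (B : Set (LK G)) (J : Submodule ℂ (LK G)) : Prop :=
  (J : Set (LK G)) ⊆ B ∧ ∀ b ∈ B, ∀ x ∈ J, b * x ∈ J ∧ x * b ∈ J

/-- The subspace `J` is invariant: `u_e^* J u_f ⊆ J` for all edges `e, f`. -/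
def IsInvariant (J : Submodule ℂ (LK G)) : Prop :=
  ∀ e f : E, ∀ x ∈ J, star (u G e) * x * u G f ∈ J

open Classical in
/-- `τ_n(c) = ∑ e_{γ₁,γ₂} ⊗ u_{ξ_{s(γ₁)}} u_{γ₁}^* c u_{γ₂} u_{ξ_{s(γ₂)}}^*`, the sum being over the
paths `γ₁, γ₂` of length `np + p - 1` with `s(γ₁) = s(γ₂)`, as a matrix indexed by these paths. -/
def tau {p : ℕ} (ξ : V → G.Path (p - 1)) (n : ℕ) (c : LK G) :
    Matrix (G.Path (n * p + (p - 1))) (G.Path (n * p + (p - 1))) (LK G) :=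
  Matrix.of fun γ₁ γ₂ => if γ₁.src = γ₂.src then
    uPath (ξ γ₁.src) * star (uPath γ₁) * c * uPath γ₂ * star (uPath (ξ γ₂.src)) else 0

/-- `Jv` is the family of corner ideals of the ideal `J` of `C_n`: each `J_v` is an ideal
of `C_v`, `τ_n(J) = ∑_{s(μ₁) = s(μ₂)} e_{μ₁,μ₂} ⊗ J_{s(μ₁)}`, and
`J_v = u_{ξ_v} u_{μ₁}^* J u_{μ₂} u_{ξ_v}^*` whenever `|μ₁| = |μ₂| = np + p - 1` and
`s(μ₁) = s(μ₂) = v`. -/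
structure IsCornerFamily (W : WeightSequence G) (p n : ℕ) (ξ : V → G.Path (p - 1))
    (J : Submodule ℂ (LK G)) (Jv : V → Submodule ℂ (LK G)) : Prop where
  isIdeal : ∀ v, IsIdealOf (Cv W p ξ v) (Jv v)
  tau_image : tau ξ n '' (J : Set (LK G)) =
    {M | ∀ μ₁ μ₂, (μ₁.src = μ₂.src → M μ₁ μ₂ ∈ Jv μ₁.src) ∧ (μ₁.src ≠ μ₂.src → M μ₁ μ₂ = 0)}
  corner : ∀ (v : V) (μ₁ μ₂ : G.Path (n * p + (p - 1))), μ₁.src = v → μ₂.src = v →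
    (Jv v : Set (LK G)) =
      (fun x => uPath (ξ v) * star (uPath μ₁) * x * uPath μ₂ * star (uPath (ξ v))) ''
        (J : Set (LK G))

/-- `π(e,f)(c) = u_{ξ_{s(e)}} u_e^* u_{ξ_{r(e)}}^* c u_{ξ_{r(f)}} u_f u_{ξ_{s(f)}}^*`, for parallel
edges `e, f` and `c ∈ C_{r(e)}`. -/
def piMap {p : ℕ} (ξ : V → G.Path (p - 1)) (e f : E) (c : LK G) : LK G :=
  uPath (ξ (G.s e)) * star (u G e) * star (uPath (ξ (G.r e))) * c *
    uPath (ξ (G.r f)) * u G f * star (uPath (ξ (G.s f)))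

end WeightedCK

end

open scoped ENNReal Topology

noncomputable section

namespace WeightedCK

section

variable {V E : Type*} {G : DirGraph V E}

/-! The argument is matrix algebra over the resolution of the identity `∑ u_α u_α^* = 1`, with `α`
running over the paths of a fixed length. On the Fock correspondence the relation `∑ S_e S_e^* = 1`
fails only on the paths of length `0`. There are finitely many paths of each length, so the defect
is compact and the quotient satisfies the Cuntz–Krieger relations exactly (`sum_uPath_mul_star`,
`star_uPath_mul_uPath`).

Put `m = np + p - 1`, the greatest length of the paths generating `C_n`. The elements `u_μ u_ν^*`
with `|μ| = |ν| = m` and `s(μ) = s(ν)` lie in `C_n` and act as matrix units. An ideal `J` is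
therefore determined by its corners, a corner depends only on the common source of the two paths
(`corner_image_subset`), and a matrix of corner elements can be reassembled into an element of `J`
(`exists_tau_eq`). Exchanging paths of length `m` for paths of length `p - 1` carries `C_n` to `C_0`
and back (`transfer_mem`), which makes the corners ideals of `C_v`. All of this uses finite sums and
products in `J`, so `J` need not be closed; closedness matters only for passing from the generators
to `C_n`.

The invariance criterion needs a second ingredient. Condition A(p) says that `Z` commutes modulo
compacts with creation by a path of length `p` (`commutator_mem_K`), so `z` commutes with `u_α` for
`|α| = p`. Hence `u_α^* z^l u_β = 0` for distinct `α, β` of equal length at most `p`, and every `c`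
in `C_n` satisfies `(u_μ u_e)^* c (u_ν u_f) = 0` whenever `e ≠ f` and `|μ| = |ν| = m`
(`star_mul_mem_C_mul_eq_zero`). A path of length `m + 1` can be split after its first edge or before
its last one. The first splitting expresses `u_e^* J u_f`, the second expresses `π`, and
`piMap_corner` links the two. Invariance thus gives the condition on `π`. Conversely, the entries of
`u_e^* x u_f` with distinct last edges vanish, and the others are controlled by `π(g,g)`. -/

theorem isPath_edges {k : ℕ} (α : G.Path k) : G.IsPath α.rng α.edges := α.2.1

theorem length_edges {k : ℕ} (α : G.Path k) : α.edges.length = k := α.2.2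

variable [Fintype V] [Fintype E]

/-! ### Coordinates of vectors in the Fock correspondence -/

/-- The path with range `v` and edges `l`. -/
def mkPath {v : V} {l : List E} (h : G.IsPath v l) : G.Path l.length := ⟨(v, l), h, rfl⟩

open Classical in
/-- The coordinate of `ξ` at the path with range `v` and edges `l`; it is `0` if there is no such
path. -/
def coord (ξ : Fock G) (v : V) (l : List E) : ℂ :=
  if h : G.IsPath v l then ξ l.length (mkPath h) else 0

theorem coord_of_isPath (ξ : Fock G) {v : V} {l : List E} (h : G.IsPath v l) :
    coord ξ v l = ξ l.length (mkPath h) := dif_pos h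

theorem apply_eq_coord (ξ : Fock G) {k : ℕ} (α : G.Path k) :
    ξ k α = coord ξ α.rng α.edges := by
  obtain ⟨⟨v, l⟩, h, rfl⟩ := α
  exact (coord_of_isPath ξ h).symm

theorem coord_of_not_isPath (ξ : Fock G) {v : V} {l : List E} (h : ¬ G.IsPath v l) :
    coord ξ v l = 0 := dif_neg h

theorem Fock.ext_coord {ξ η : Fock G} (h : ∀ v l, G.IsPath v l → coord ξ v l = coord η v l) :
    ξ = η := by
  apply lp.ext; funext k; ext α
  rw [apply_eq_coord, apply_eq_coord]
  exact h _ _ α.2.1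

theorem coord_add (ξ η : Fock G) (v : V) (l : List E) :
    coord (ξ + η) v l = coord ξ v l + coord η v l := by
  unfold coord
  split_ifs
  · rfl
  · simp

theorem coord_sub (ξ η : Fock G) (v : V) (l : List E) :
    coord (ξ - η) v l = coord ξ v l - coord η v l := by
  unfold coord
  split_ifs
  · rfl
  · simp

theorem coord_zero (v : V) (l : List E) : coord (0 : Fock G) v l = 0 := by
  unfold coord
  split_ifs <;> rfl

theorem coord_sum {ι : Type*} (s : Finset ι) (f : ι → Fock G) (v : V) (l : List E) :
    coord (∑ i ∈ s, f i) v l = ∑ i ∈ s, coord (f i) v l := by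
  classical
  induction s using Finset.induction_on with
  | empty => simp [coord_zero]
  | insert a s ha ih => rw [Finset.sum_insert ha, Finset.sum_insert ha, coord_add, ih]

theorem coord_S_nil (e : E) (ξ : Fock G) (v : V) : coord ((S G e).1 ξ) v [] = 0 := by
  unfold coord
  split_ifs <;> rfl

open Classical in
theorem coord_S_cons (e f : E) (ξ : Fock G) (v : V) (l : List E) :
    coord ((S G e).1 ξ) v (f :: l) = if G.r f = v ∧ f = e then coord ξ (G.s f) l else 0 := by
  by_cases h : G.IsPath v (f :: l)
  · rw [coord, dif_pos h, coord, dif_pos h.2]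
    change (if f = e then _ else _) = _
    simp only [h.1, true_and]
    rfl
  · rw [coord_of_not_isPath _ h]
    split_ifs with h'
    · rw [coord_of_not_isPath _ fun h2 => h ⟨h'.1, h2⟩]
    · rfl

open Classical in
theorem coord_P (w : V) (ξ : Fock G) (v : V) (l : List E) :
    coord ((P G w).1 ξ) v l = if v = w then coord ξ v l else 0 := by
  unfold coord
  by_cases h : G.IsPath v l
  · simp only [h, dite_true]
    change (Pi.single w (1 : ℂ) : V → ℂ) v * _ = _
    by_cases hv : v = w
    · subst hv; simp
    · simp [hv]
  · simp [h]

open Classical in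
/-- The basis vector `δ_α` of the Fock correspondence. -/
def deltaFock {k : ℕ} (α : G.Path k) : Fock G :=
  lp.single 2 k (EuclideanSpace.single α 1)

theorem inner_deltaFock {k : ℕ} (α : G.Path k) (ξ : Fock G) :
    inner ℂ (deltaFock α) ξ = ξ k α := by
  classical
  rw [deltaFock, lp.inner_single_left, EuclideanSpace.inner_single_left]
  simp

open Classical in
theorem coord_deltaFock {k : ℕ} (α : G.Path k) (v : V) (l : List E) :
    coord (deltaFock α) v l = if α.rng = v ∧ α.edges = l then 1 else 0 := by
  by_cases h' : G.IsPath v l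
  · rw [coord_of_isPath _ h']
    by_cases hl : l.length = k
    · subst hl
      rw [deltaFock, lp.single_apply_self]
      refine (PiLp.single_apply 2 ℂ α 1 _).trans ?_
      refine if_congr ⟨fun h => ?_, fun h => ?_⟩ rfl rfl
      · rw [← h]; exact ⟨rfl, rfl⟩
      · exact Subtype.ext (Prod.ext h.1.symm h.2.symm)
    · rw [deltaFock, lp.single_apply_ne _ _ _ hl, if_neg]
      · rfl
      · rintro ⟨-, rfl⟩
        exact hl α.2.2
  · rw [coord_of_not_isPath _ h', if_neg]
    rintro ⟨rfl, rfl⟩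
    exact h' α.2.1

/-- The path `eβ`, for `s(e) = r(β)`. -/
def consPath {k : ℕ} (e : E) (β : G.Path k) (h : G.s e = β.rng) : G.Path (k + 1) :=
  ⟨(G.r e, e :: β.edges), ⟨rfl, by rw [h]; exact β.2.1⟩, by
    rw [List.length_cons]; exact congrArg Nat.succ β.2.2⟩

theorem S_deltaFock (e : E) {k : ℕ} (β : G.Path k) (h : G.s e = β.rng) :
    (S G e).1 (deltaFock β) = deltaFock (consPath e β h) := by
  classical
  refine Fock.ext_coord fun v l _ => ?_
  cases l with
  | nil =>
    rw [coord_S_nil, coord_deltaFock, if_neg]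
    rintro ⟨-, h⟩
    exact List.cons_ne_nil _ _ h
  | cons f l =>
    rw [coord_S_cons, coord_deltaFock, coord_deltaFock, ← ite_and]
    refine if_congr ⟨?_, ?_⟩ rfl rfl
    · rintro ⟨⟨rfl, rfl⟩, -, rfl⟩
      exact ⟨rfl, rfl⟩
    · rintro ⟨rfl, h'⟩
      obtain ⟨rfl, rfl⟩ := List.cons.inj h'
      exact ⟨⟨rfl, rfl⟩, h.symm, rfl⟩

theorem S_deltaFock_of_ne (e : E) {k : ℕ} (β : G.Path k) (h : G.s e ≠ β.rng) :
    (S G e).1 (deltaFock β) = 0 := by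
  classical
  refine Fock.ext_coord fun v l _ => ?_
  rw [coord_zero]
  cases l with
  | nil => rw [coord_S_nil]
  | cons f l =>
    rw [coord_S_cons, coord_deltaFock, ← ite_and, if_neg]
    rintro ⟨⟨-, rfl⟩, h', -⟩
    exact h h'.symm

theorem coord_star (T : L G) (ξ : Fock G) {v : V} {l : List E} (h : G.IsPath v l) :
    coord ((star T).1 ξ) v l = inner ℂ (T.1 (deltaFock (mkPath h))) ξ := by
  rw [coord_of_isPath _ h, ← inner_deltaFock]
  exact ContinuousLinearMap.adjoint_inner_right _ _ _

open Classical in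
theorem coord_star_S (e : E) (ξ : Fock G) (v : V) (l : List E) :
    coord ((star (S G e)).1 ξ) v l = if v = G.s e then coord ξ (G.r e) (e :: l) else 0 := by
  by_cases hl : G.IsPath v l
  · rw [coord_star _ _ hl]
    by_cases hv : v = G.s e
    · rw [if_pos hv, S_deltaFock e (mkPath hl) hv.symm, inner_deltaFock, apply_eq_coord]
      rfl
    · rw [if_neg hv, S_deltaFock_of_ne e (mkPath hl) fun h => hv h.symm, inner_zero_left]
  · rw [coord_of_not_isPath _ hl]
    split_ifs with hv
    · subst hv
      have : ¬ G.IsPath (G.r e) (e :: l) := fun h => hl h.2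
      rw [coord_of_not_isPath _ this]
    · rfl

/-! ### Relations in `𝓛(𝓕(X_E))` -/

/-- Relations between operators are checked one coordinate at a time, where they become statements
about lists of edges. -/
theorem L.ext_coord {S T : L G}
    (h : ∀ ξ v l, G.IsPath v l → coord (S.1 ξ) v l = coord (T.1 ξ) v l) : S = T :=
  Subtype.ext (ContinuousLinearMap.ext fun ξ => Fock.ext_coord fun v l hl => h ξ v l hl)

theorem L.mul_apply (S T : L G) (ξ : Fock G) : (S * T).1 ξ = S.1 (T.1 ξ) := rfl

theorem L.zero_apply (ξ : Fock G) : (0 : L G).1 ξ = 0 := rfl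

theorem L.sum_apply {ι : Type*} (s : Finset ι) (f : ι → L G) (ξ : Fock G) :
    (∑ i ∈ s, f i).1 ξ = ∑ i ∈ s, (f i).1 ξ := by
  rw [AddSubmonoidClass.coe_finsetSum, _root_.sum_apply]

theorem star_P (v : V) : star (P G v) = P G v := by
  classical
  refine L.ext_coord fun ξ x l hl => ?_
  rw [coord_star _ _ hl, coord_P]
  have : (P G v).1 (deltaFock (mkPath hl)) = if x = v then deltaFock (mkPath hl) else 0 := by
    refine Fock.ext_coord fun y m _ => ?_
    rw [coord_P]
    split_ifs with h1 h2 h2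
    · rfl
    · rw [coord_deltaFock, coord_zero, if_neg]
      rintro ⟨h, -⟩
      exact h2 (Eq.trans h h1)
    · rw [coord_deltaFock, if_neg]
      rintro ⟨h, -⟩
      exact h1 (Eq.trans h.symm h2)
    · rw [coord_zero]
  rw [this]
  split_ifs
  · rw [inner_deltaFock, coord_of_isPath _ hl]
  · rw [inner_zero_left]

open Classical in
theorem P_mul_P (v w : V) : P G v * P G w = if v = w then P G v else 0 := by
  refine L.ext_coord fun ξ x l _ => ?_
  rw [L.mul_apply, coord_P, coord_P]
  split_ifs with h1 h2 h3 h3 h4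
  · rw [coord_P, if_pos h1]
  · exact absurd (h1.symm.trans h2) h3
  · exact absurd (h1.trans h3) h2
  · exact (coord_zero x l).symm
  · rw [coord_P, if_neg h1]
  · exact (coord_zero x l).symm

theorem sum_P : ∑ v, P G v = 1 := by
  classical
  refine L.ext_coord fun ξ x l _ => ?_
  rw [L.sum_apply, coord_sum]
  simp only [coord_P, Finset.sum_ite_eq, Finset.mem_univ, if_true]
  rfl

open Classical in
theorem P_mul_S (v : V) (e : E) : P G v * S G e = if G.r e = v then S G e else 0 := by
  refine L.ext_coord fun ξ x l _ => ?_
  rw [L.mul_apply, coord_P]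
  cases l with
  | nil =>
    split_ifs <;> simp only [coord_S_nil, L.zero_apply, coord_zero]
  | cons f l =>
    split_ifs with h1 h2 h2
    · rfl
    · rw [L.zero_apply, coord_zero, coord_S_cons, if_neg]
      rintro ⟨h, rfl⟩
      exact h2 (h.trans h1)
    · rw [coord_S_cons, if_neg]
      rintro ⟨h, rfl⟩
      exact h1 (h.symm.trans h2)
    · rw [L.zero_apply, coord_zero]

open Classical in
theorem S_mul_P (v : V) (e : E) : S G e * P G v = if G.s e = v then S G e else 0 := by
  refine L.ext_coord fun ξ x l _ => ?_
  rw [L.mul_apply]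
  cases l with
  | nil =>
    split_ifs <;> simp only [coord_S_nil, L.zero_apply, coord_zero]
  | cons f l =>
    rw [coord_S_cons, coord_P]
    split_ifs with h1 h2 h3 h3 h4
    · rw [coord_S_cons, if_pos h1]
    · exact absurd (h1.2 ▸ h2) h3
    · exact absurd (h1.2.symm ▸ h3) h2
    · rw [L.zero_apply, coord_zero]
    · rw [coord_S_cons, if_neg h1]
    · rw [L.zero_apply, coord_zero]

open Classical in
theorem star_S_mul_S (e f : E) : star (S G e) * S G f = if e = f then P G (G.s e) else 0 := by
  refine L.ext_coord fun ξ x l _ => ?_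
  rw [L.mul_apply, coord_star_S, coord_S_cons]
  by_cases h : e = f
  · subst h
    rw [if_pos rfl, coord_P]
    simp only [and_self, if_true]
    split_ifs with h
    · rw [h]
    · rfl
  · simp [h, coord_zero]

/-! ### Diagonal operators and compactness of the projections onto short paths -/

/-- The diagonal operator that multiplies the coordinate at a path with range `v` and edges `l`
by `g v l`. -/
def multFock (g : V → List E → ℂ) (hg : ∀ v l, ‖g v l‖ ≤ 1) : L G :=
  ⟨diag G (fun _ => mulX G fun α => g α.rng α.edges)
    ⟨1, fun _ => norm_mulX_le G zero_le_one fun _ => hg _ _⟩, mem_L_of_commute G fun a ξ => by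
      apply lp.ext; funext k; ext α
      change _ * (_ * _) = _ * (_ * _)
      ring⟩

theorem coord_multFock (g : V → List E → ℂ) (hg : ∀ v l, ‖g v l‖ ≤ 1) (ξ : Fock G) (v : V)
    (l : List E) : coord ((multFock g hg).1 ξ) v l = g v l * coord ξ v l := by
  by_cases h : G.IsPath v l
  · rw [coord_of_isPath _ h, coord_of_isPath _ h]
    rfl
  · rw [coord_of_not_isPath _ h, coord_of_not_isPath _ h, mul_zero]

theorem norm_multFock_apply_le (g : V → List E → ℂ) (hg : ∀ v l, ‖g v l‖ ≤ 1) (ξ : Fock G) :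
    ‖(multFock g hg).1 ξ‖ ≤ ‖ξ‖ := by
  refine lp.norm_mono (by norm_num) fun k => ?_
  refine (ContinuousLinearMap.le_of_opNorm_le _
    (norm_mulX_le G zero_le_one fun _ => hg _ _) _).trans ?_
  rw [one_mul]

theorem norm_indicator_le (c : Prop) [Decidable c] : ‖if c then (1 : ℂ) else 0‖ ≤ 1 := by
  split_ifs <;> simp

open Classical in
/-- The projection onto the line spanned by `δ_α`. -/
def pathProj {k : ℕ} (α : G.Path k) : L G :=
  multFock (fun v l => if α.rng = v ∧ α.edges = l then 1 else 0) fun _ _ => norm_indicator_le _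

/-- The projection is `θ_{ξ,η}` with `ξ = η = δ_α`: the function `⟨δ_α, ζ⟩` takes the value `ζ(α)`
at `s(α)`, and this is the only value that the right action on `δ_α` sees. -/
theorem isTheta_pathProj {k : ℕ} (α : G.Path k) : IsTheta G (pathProj α) := by
  classical
  refine ⟨deltaFock α, deltaFock α, fun ζ => Fock.ext_coord fun v l h => ?_⟩
  rw [pathProj, coord_multFock, coord_of_isPath (rightFock G _ _) h, rightFock_apply,
    apply_eq_coord (deltaFock α), innerA_eq, inner_deltaFock, rightFock_apply]
  change _ = _ * coord _ v l
  rw [coord_deltaFock]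
  split_ifs with h1
  · obtain ⟨rfl, rfl⟩ := h1
    rw [one_mul, mul_one, apply_eq_coord]
    change _ = (Pi.single α.src 1 : V → ℂ) α.src * _
    rw [Pi.single_eq_same, one_mul]
  · simp

/-- The projection onto the vectors supported on the paths of length less than `N`. -/
def levelProj (N : ℕ) : L G :=
  multFock (fun _ l => if l.length < N then 1 else 0) fun _ _ => norm_indicator_le _

theorem levelProj_succ (N : ℕ) :
    levelProj (N + 1) = levelProj N + ∑ α : G.Path N, pathProj α := by
  classical
  refine L.ext_coord fun ξ v l h => ?_
  change _ = coord ((levelProj N).1 ξ + (∑ α : G.Path N, pathProj α).1 ξ) v l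
  rw [coord_add, L.sum_apply, coord_sum]
  simp only [levelProj, pathProj, coord_multFock]
  rw [← Finset.sum_mul, ← add_mul]
  congr 1
  rcases lt_trichotomy l.length N with hl | hl | hl
  · rw [if_pos (by omega), if_pos hl, Finset.sum_eq_zero, add_zero]
    intro α _
    rw [if_neg]
    rintro ⟨-, rfl⟩
    exact hl.ne α.2.2
  · subst hl
    rw [if_pos (by omega), if_neg (by omega), Finset.sum_eq_single (mkPath h), if_pos, zero_add]
    · exact ⟨rfl, rfl⟩
    · intro α _ hα
      rw [if_neg]
      rintro ⟨rfl, h2⟩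
      exact hα (Subtype.ext (Prod.ext rfl h2))
    · simp
  · rw [if_neg (by omega), if_neg (by omega), Finset.sum_eq_zero, add_zero]
    intro α _
    rw [if_neg]
    rintro ⟨-, rfl⟩
    exact hl.ne' α.2.2

/-- Each level contributes finitely many rank one projections because the graph is finite. -/
theorem levelProj_mem_K (N : ℕ) : levelProj N ∈ K G := by
  induction N with
  | zero =>
    convert (K G).zero_mem
    refine L.ext_coord fun ξ v l h => ?_
    rw [levelProj, coord_multFock, L.zero_apply, coord_zero]
    simp
  | succ N ih =>
    rw [levelProj_succ]
    exact (K G).add_mem ih ((K G).sum_mem fun α _ =>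
      subset_closure (Submodule.subset_span (isTheta_pathProj α)))

/-- A path with an edge is fixed by `S_e S_e^*` exactly for its first edge `e`; the paths of length
`0` are killed by every term. -/
theorem sum_S_mul_star_S : ∑ e, S G e * star (S G e) = 1 - levelProj 1 := by
  classical
  refine L.ext_coord fun ξ v l h => ?_
  change _ = coord (ξ - (levelProj 1).1 ξ) v l
  rw [L.sum_apply, coord_sum, coord_sub, levelProj, coord_multFock]
  simp only [L.mul_apply]
  cases l with
  | nil => simp [coord_S_nil]
  | cons f l =>
    simp only [coord_S_cons, h.1, true_and, Finset.sum_ite_eq, Finset.mem_univ, if_true]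
    rw [coord_star_S, if_pos rfl, h.1]
    simp

theorem isClosed_K : IsClosed (K G : Set (L G)) := isClosed_closure

/-- An operator is compact if it is small on the vectors supported on long paths. -/
theorem mem_K_of_norm_le {T : L G}
    (h : ∀ ε : ℝ, 0 < ε → ∃ N : ℕ, ‖T * (1 - levelProj N)‖ ≤ ε) : T ∈ K G := by
  have : T ∈ closure (K G : Set (L G)) := by
    refine Metric.mem_closure_iff.2 fun ε hε => ?_
    obtain ⟨N, hN⟩ := h (ε / 2) (by positivity)
    refine ⟨T * levelProj N, (K G).mul_mem_left _ (levelProj_mem_K N), ?_⟩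
    rw [dist_eq_norm]
    rw [mul_sub, mul_one] at hN
    linarith
  rwa [isClosed_K.closure_eq] at this

/-! ### The topology of the quotient -/

theorem isQuotientMap_q : Topology.IsQuotientMap (q G) :=
  isQuotientMap_quotient_mk'

theorem q_eq_zero_iff {T : L G} : q G T = 0 ↔ T ∈ K G := Ideal.Quotient.eq_zero_iff_mem

/-- Since `K` is closed, vanishing is a closed condition in the quotient; this extends identities
from generators to the generated `C^*`-algebra. -/
theorem isClosed_singleton_zero : IsClosed ({0} : Set (LK G)) := by
  rw [← isQuotientMap_q.isClosed_preimage]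
  convert isClosed_K (G := G)
  ext T
  exact q_eq_zero_iff

/-- Continuity in the middle factor alone suffices for the closure arguments below, and it descends
from `L G` along the quotient map. -/
theorem continuous_mul_mul (a b : LK G) : Continuous fun x : LK G => a * x * b := by
  obtain ⟨S, rfl⟩ := q_surjective G a
  obtain ⟨T, rfl⟩ := q_surjective G b
  refine isQuotientMap_q.continuous_iff.2 ?_
  have : ((fun x : LK G => q G S * x * q G T) ∘ q G) = fun x => q G (S * x * T) := by
    funext x
    simp only [Function.comp, map_mul]
  rw [this]
  exact isQuotientMap_q.continuous.comp (by fun_prop)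

/-! ### Commutation of the weight with creation operators -/

/-- The product `S_{e₁} ⋯ S_{eₖ}`. -/
def SProd (m : List E) : L G := (m.map (S G)).prod

open Classical in
theorem coord_SProd (m : List E) (ξ : Fock G) {v : V} {l : List E} (h : G.IsPath v l) :
    coord ((SProd m).1 ξ) v l =
      if m <+: l then coord ξ (G.endpoint v m) (l.drop m.length) else 0 := by
  induction m generalizing v l with
  | nil =>
    rw [if_pos List.nil_prefix]
    rfl
  | cons e m ih =>
    have h1 : (SProd (e :: m) : L G) = S G e * SProd m := by simp [SProd]
    rw [h1, L.mul_apply]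
    cases l with
    | nil => rw [coord_S_nil, if_neg (by simp)]
    | cons f l =>
      rw [coord_S_cons]
      by_cases hf : f = e
      · subst hf
        rw [if_pos ⟨h.1, rfl⟩, ih h.2]
        refine if_congr ?_ rfl rfl
        rw [List.cons_prefix_cons]
        simp
      · rw [if_neg fun h' => hf h'.2, if_neg]
        rw [List.cons_prefix_cons]
        exact fun h' => hf h'.1.symm

-- Writing the level as `m.length + k` matches the decomposition of a path into `initial` and
-- `final` that `idTensor` uses.
open Classical in
theorem SProd_apply_add (m : List E) (ξ : Fock G) {k : ℕ} (α : G.Path (m.length + k)) :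
    (SProd m).1 ξ (m.length + k) α =
      if m = α.edges.take m.length then ξ k α.final else 0 := by
  rw [apply_eq_coord, coord_SProd _ _ (isPath_edges α), apply_eq_coord]
  by_cases hm : m = α.edges.take m.length
  · rw [if_pos hm, if_pos (List.prefix_iff_eq_take.2 hm)]
    have : G.endpoint α.rng m = α.final.rng := congrArg (G.endpoint α.rng) hm
    rw [this]
    rfl
  · rw [if_neg hm, if_neg fun h => hm (List.prefix_iff_eq_take.1 h)]

theorem leftX_apply (k : ℕ) (a : V → ℂ) (ξ : X G k) (α : G.Path k) :
    leftX G k a ξ α = a α.rng * ξ α := rfl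

/-- This is `(I ⊗ T) S_m = S_m T` on level `k`. Slicing `S_m ξ` along its initial path gives `ξ` cut
down to the paths that can be appended. The cut is a left action, so it commutes with `T`, and it is
invisible at `α.final`. -/
theorem idTensor_SProd (m : List E) (k : ℕ) (T : X G k →L[ℂ] X G k)
    (hT : ∀ a, T * leftX G k a = leftX G k a * T) (ξ η : Fock G) (hη : η k = T (ξ k)) :
    idTensor G m.length T ((SProd m).1 ξ (m.length + k)) = (SProd m).1 η (m.length + k) := by
  classical
  ext α
  have hs : ∀ γ : G.Path k, sliceX G k α.initial ((SProd m).1 ξ (m.length + k)) γ =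
      if α.initial.src = γ.rng ∧ m = α.edges.take m.length then ξ k γ else 0 := by
    intro γ
    change (if h : α.initial.src = γ.rng then
      (SProd m).1 ξ (m.length + k) (α.initial.append γ h) else 0) = _
    by_cases h : α.initial.src = γ.rng
    · have hlen : (α.edges.take m.length).length = m.length := α.initial.2.2
      have he : (α.initial.append γ h).edges.take m.length = α.edges.take m.length :=
        List.take_left' hlen
      have hf : (α.initial.append γ h).final = γ := by
        refine Subtype.ext (Prod.ext ?_ (List.drop_left' hlen))
        refine Eq.trans ?_ h
        change G.endpoint α.rng ((α.initial.append γ h).edges.take m.length) = _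
        rw [he]
        rfl
      rw [dif_pos h, SProd_apply_add, he, hf]
      simp only [h, true_and]
    · rw [dif_neg h, if_neg fun h' => h h'.1]
  change T (sliceX G k α.initial ((SProd m).1 ξ (m.length + k))) α.final = _
  rw [SProd_apply_add]
  by_cases hm : m = α.edges.take m.length
  · have h1 : sliceX G k α.initial ((SProd m).1 ξ (m.length + k)) =
        leftX G k (Pi.single α.initial.src 1) (ξ k) := by
      ext γ
      rw [hs, leftX_apply]
      by_cases h : α.initial.src = γ.rng
      · simp [h, ← hm]
      · simp [h, Ne.symm h]
    rw [h1, if_pos hm]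
    have h2 := DFunLike.congr_fun (hT (Pi.single α.initial.src 1)) (ξ k)
    change T (leftX G k _ (ξ k)) = leftX G k _ (T (ξ k)) at h2
    rw [h2, leftX_apply]
    have h4 : α.final.rng = α.initial.src := rfl
    rw [hη, h4, Pi.single_eq_same, one_mul]
  · have h1 : sliceX G k α.initial ((SProd m).1 ξ (m.length + k)) = 0 := by
      ext γ
      rw [hs, if_neg fun h => hm h.2]
      rfl
    rw [h1, map_zero, if_neg hm]
    rfl

theorem WeightSequence.op_apply (W : WeightSequence G) (ξ : Fock G) (k : ℕ) :
    W.op.1 ξ k = W.Z k (ξ k) := rfl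

theorem SProd_apply_of_lt (m : List E) (ξ : Fock G) {j : ℕ} (h : j < m.length) :
    (SProd m).1 ξ j = 0 := by
  classical
  ext α
  rw [apply_eq_coord, coord_SProd _ _ (isPath_edges α), if_neg]
  · rfl
  · intro h'
    have : m.length ≤ α.edges.length := h'.length_le
    have h2 : α.edges.length = j := α.2.2
    omega

/-- On level `k` the commutator equals `(Z_{p+k} - I_p ⊗ Z_k) S_m` with `p = m.length`. Condition
A(p) makes it uniformly small for large `k`, and such an operator is compact. -/
theorem commutator_mem_K (W : WeightSequence G) (m : List E) (hA : ConditionA W m.length) :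
    W.op * SProd m - SProd m * W.op ∈ K G := by
  classical
  refine mem_K_of_norm_le fun ε hε => ?_
  -- The bound `δ` on the weight differences is multiplied by the norm of `SProd m` at the end; the
  -- `+ 1` keeps the divisor positive.
  have hδ : 0 < ε / (‖(SProd m : L G)‖ + 1) := by positivity
  set δ := ε / (‖(SProd m : L G)‖ + 1) with hδ_def
  obtain ⟨N, hN⟩ := Filter.eventually_atTop.1 (hA.eventually_lt_const hδ)
  refine ⟨N, ?_⟩
  refine ContinuousLinearMap.opNorm_le_bound _ hε.le fun ξ => ?_
  set η : Fock G := (1 - levelProj N : L G).1 ξ with hη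
  -- As a multiplier by `0` or `1`, the complementary projection is visibly contractive and kills
  -- the levels below `N`.
  have hη' : η = (multFock (fun _ l => if l.length < N then 0 else 1) fun _ _ => by
      split_ifs <;> simp : L G).1 ξ := by
    refine Fock.ext_coord fun v l _ => ?_
    change coord (ξ - (levelProj N).1 ξ) v l = _
    rw [coord_sub, levelProj, coord_multFock, coord_multFock]
    split_ifs <;> simp
  have hnorm : ‖η‖ ≤ ‖ξ‖ := by
    rw [hη']
    exact norm_multFock_apply_le _ _ _
  have hzero : ∀ k, k < N → η k = 0 := by
    intro k hk
    ext α
    have h2 : α.edges.length = k := α.2.2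
    rw [apply_eq_coord, hη', coord_multFock, if_pos (by omega), zero_mul]
    rfl
  change ‖W.op.1 ((SProd m).1 η) - (SProd m).1 (W.op.1 η)‖ ≤ _
  -- Levels below `m.length` vanish. On level `m.length + k` both sides vanish if `k < N`, and the
  -- choice of `N` applies otherwise.
  have hcomp : ∀ j, ‖(W.op.1 ((SProd m).1 η) - (SProd m).1 (W.op.1 η) : Fock G) j‖ ≤
      ‖((δ : ℂ) • (SProd m).1 η : Fock G) j‖ := by
    intro j
    rw [lp.coeFn_smul, Pi.smul_apply, norm_smul, Complex.norm_real, Real.norm_of_nonneg hδ.le,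
      lp.coeFn_sub, Pi.sub_apply, W.op_apply]
    rcases lt_or_ge j m.length with hj | hj
    · rw [SProd_apply_of_lt _ _ hj, SProd_apply_of_lt _ _ hj]
      simp
    · obtain ⟨k, rfl⟩ := Nat.exists_eq_add_of_le hj
      rw [← idTensor_SProd m k (W.Z k) (W.commute_left k) η (W.op.1 η) rfl]
      rcases lt_or_ge k N with hk | hk
      · have : (SProd m).1 η (m.length + k) = 0 := by
          ext α
          rw [SProd_apply_add, hzero k hk]
          split_ifs <;> rfl
        rw [this]
        simp
      · rw [← _root_.sub_apply, ← norm_neg, ← _root_.neg_apply, neg_sub]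
        exact ContinuousLinearMap.le_of_opNorm_le _ (hN k hk).le _
  refine (lp.norm_mono (by norm_num) hcomp).trans ?_
  rw [norm_smul, Complex.norm_real, Real.norm_of_nonneg hδ.le]
  calc δ * ‖(SProd m).1 η‖ ≤ δ * (‖(SProd m : L G)‖ * ‖ξ‖) := by
        gcongr
        exact ((SProd m).1.le_opNorm η).trans (by gcongr; rfl)
    _ ≤ δ * ((‖(SProd m : L G)‖ + 1) * ‖ξ‖) := by gcongr; linarith
    _ = ε * ‖ξ‖ := by rw [hδ_def]; field_simp

end

section

variable {V E : Type*} {G : DirGraph V E}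

/-! ### Composition of paths -/

theorem endpoint_append (v : V) (l m : List E) :
    G.endpoint v (l ++ m) = G.endpoint (G.endpoint v l) m := by
  induction l generalizing v with
  | nil => rfl
  | cons e l ih => exact ih _

theorem path_ext {k : ℕ} {α β : G.Path k} (h : α.rng = β.rng) (h' : α.edges = β.edges) : α = β :=
  Subtype.ext (Prod.ext h h')

theorem src_append {j k : ℕ} (α : G.Path j) (β : G.Path k) (h : α.src = β.rng) :
    (α.append β h).src = β.src := by
  refine (endpoint_append α.rng α.edges β.edges).trans ?_
  exact congrArg (fun v => G.endpoint v β.edges) h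

theorem src_final {j k : ℕ} (α : G.Path (j + k)) : α.final.src = α.src := by
  change G.endpoint (G.endpoint _ (List.take j _)) (List.drop j _) = G.endpoint _ _
  rw [← endpoint_append, List.take_append_drop]

theorem src_initial {j k : ℕ} (α : G.Path (j + k)) : α.initial.src = α.final.rng := rfl

/-- In a graph without sinks every vertex is the source of a path of length `k`. -/
theorem exists_path_src_eq (hG : G.NoSinks) (k : ℕ) (v : V) : ∃ α : G.Path k, α.src = v := by
  induction k with
  | zero => exact ⟨⟨(v, []), trivial, rfl⟩, rfl⟩
  | succ k ih =>
    obtain ⟨α, hα⟩ := ih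
    obtain ⟨e, he⟩ := hG α.rng
    refine ⟨⟨(G.r e, e :: α.edges), ⟨rfl, he ▸ isPath_edges α⟩, ?_⟩, ?_⟩
    · rw [List.length_cons, length_edges]
    · change G.endpoint (G.s e) α.edges = v
      rw [he]
      exact hα

/-- The path of length one given by an edge. -/
def edgePath (G : DirGraph V E) (e : E) : G.Path 1 := ⟨(G.r e, [e]), ⟨rfl, trivial⟩, rfl⟩

theorem rng_edgePath (e : E) : (edgePath G e).rng = G.r e := rfl

theorem src_edgePath (e : E) : (edgePath G e).src = G.s e := rfl

theorem exists_eq_edgePath (α : G.Path 1) : ∃ e, α = edgePath G e := by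
  obtain ⟨⟨v, l⟩, h, hl⟩ := α
  obtain ⟨e, rfl⟩ := List.length_eq_one_iff.1 hl
  exact ⟨e, path_ext h.1.symm rfl⟩

variable [Fintype V] [Fintype E]

/-! ### Relations in the quotient -/

/-- The projection `q(P_v)`. -/
def pv (G : DirGraph V E) (v : V) : LK G := q G (P G v)

theorem star_pv (v : V) : star (pv G v) = pv G v := by rw [pv, star_q, star_P]

open Classical in
theorem pv_mul_pv (v w : V) : pv G v * pv G w = if v = w then pv G v else 0 := by
  rw [pv, pv, ← map_mul, P_mul_P]
  split_ifs <;> simp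

theorem pv_mul_self (v : V) : pv G v * pv G v = pv G v := by
  rw [pv_mul_pv, if_pos rfl]

theorem sum_pv : ∑ v, pv G v = 1 := by
  simp only [pv]
  rw [← map_sum, sum_P, map_one]

open Classical in
theorem pv_mul_u (v : V) (e : E) : pv G v * u G e = if G.r e = v then u G e else 0 := by
  rw [pv, u, ← map_mul, P_mul_S]
  split_ifs <;> simp

open Classical in
theorem u_mul_pv (v : V) (e : E) : u G e * pv G v = if G.s e = v then u G e else 0 := by
  rw [pv, u, ← map_mul, S_mul_P]
  split_ifs <;> simp

open Classical in
theorem star_u_mul_u (e f : E) : star (u G e) * u G f = if e = f then pv G (G.s e) else 0 := by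
  rw [pv, u, u, star_q, ← map_mul, star_S_mul_S]
  split_ifs <;> simp

theorem sum_u_mul_star_u : ∑ e, u G e * star (u G e) = 1 := by
  simp only [u, star_q, ← map_mul]
  rw [← map_sum, sum_S_mul_star_S, map_sub, map_one, q_eq_zero_iff.2 (levelProj_mem_K 1), sub_zero]

theorem z_mul_pv (W : WeightSequence G) (v : V) : W.z * pv G v = pv G v * W.z := by
  classical
  rw [pv, WeightSequence.z, ← map_mul, ← map_mul]
  congr 1
  refine Subtype.ext (ContinuousLinearMap.ext fun ξ => lp.ext (funext fun k => ?_))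
  exact DFunLike.congr_fun (W.commute_left k (Pi.single v 1)) (ξ k)

/-! ### The elements `u_α` -/

/-- The element `u_α` for the path `α` with range `v` and edges `l`. -/
def uList (G : DirGraph V E) (v : V) (l : List E) : LK G := pv G v * (l.map (u G)).prod

theorem uList_nil (v : V) : uList G v [] = pv G v := by simp [uList]

theorem uList_cons {v : V} {e : E} (h : G.r e = v) (l : List E) :
    uList G v (e :: l) = u G e * uList G (G.s e) l := by
  rw [uList, uList, List.map_cons, List.prod_cons, ← mul_assoc, ← mul_assoc, pv_mul_u, if_pos h,
    u_mul_pv, if_pos rfl]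

/-- The factor `p_v` in `uList` is absorbed by the first edge and is all that remains for a vertex,
so paths of length `0` no longer need a separate case. -/
theorem uPath_eq_uList {k : ℕ} (α : G.Path k) : uPath α = uList G α.rng α.edges := by
  obtain ⟨⟨v, l⟩, h, rfl⟩ := α
  cases l with
  | nil => exact (uList_nil v).symm
  | cons e l =>
    change ((e :: l).map (u G)).prod = uList G v (e :: l)
    rw [uList, List.map_cons, List.prod_cons, ← mul_assoc, pv_mul_u, if_pos h.1]

theorem uList_mul_pv {v : V} {l : List E} (h : G.IsPath v l) :
    uList G v l * pv G (G.endpoint v l) = uList G v l := by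
  induction l generalizing v with
  | nil => rw [uList_nil]; exact pv_mul_self v
  | cons e l ih =>
    rw [uList_cons h.1, mul_assoc]
    exact congrArg _ (ih h.2)

theorem uList_append {v : V} {l : List E} (h : G.IsPath v l) (m : List E) :
    uList G v (l ++ m) = uList G v l * uList G (G.endpoint v l) m := by
  induction l generalizing v with
  | nil =>
    rw [uList_nil, List.nil_append]
    change _ = pv G v * (pv G v * _)
    rw [← mul_assoc, pv_mul_self]
    rfl
  | cons e l ih =>
    rw [List.cons_append, uList_cons h.1, uList_cons h.1, ih h.2, mul_assoc]
    rfl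

-- Peel off first edges: distinct ones are orthogonal, equal ones leave a projection that the next
-- factor absorbs. Equal lengths make both lists run out together.
open Classical in
theorem star_uList_mul_uList {v w : V} {l m : List E} (hl : G.IsPath v l) (hm : G.IsPath w m)
    (h : l.length = m.length) : star (uList G v l) * uList G w m =
      if v = w ∧ l = m then pv G (G.endpoint v l) else 0 := by
  induction l generalizing v w m with
  | nil =>
    obtain rfl : m = [] := List.length_eq_zero_iff.1 h.symm
    rw [uList_nil, uList_nil, star_pv, pv_mul_pv]
    simp only [and_true]
    rfl
  | cons e l ih =>
    cases m with
    | nil => simp at h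
    | cons f m =>
      rw [uList_cons hl.1, uList_cons hm.1, star_mul, mul_assoc, ← mul_assoc (star (u G e)),
        star_u_mul_u]
      by_cases hef : e = f
      · subst hef
        have hvw : v = w := hl.1.symm.trans hm.1
        have h1 : pv G (G.s e) * uList G (G.s e) m = uList G (G.s e) m := by
          rw [uList, ← mul_assoc, pv_mul_self]
        rw [if_pos rfl, h1, ih hl.2 hm.2 (by simpa using h)]
        simp only [hvw, true_and, List.cons.injEq]
        rfl
      · rw [if_neg hef, zero_mul, mul_zero, if_neg]
        rintro ⟨-, h'⟩
        exact hef (List.cons.inj h').1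

theorem pv_mul_uPath {k : ℕ} (α : G.Path k) : pv G α.rng * uPath α = uPath α := by
  rw [uPath_eq_uList, uList, ← mul_assoc, pv_mul_self]

theorem uPath_mul_pv {k : ℕ} (α : G.Path k) : uPath α * pv G α.src = uPath α := by
  rw [uPath_eq_uList]
  exact uList_mul_pv (isPath_edges α)

open Classical in
theorem star_uPath_mul_uPath {k : ℕ} (α β : G.Path k) :
    star (uPath α) * uPath β = if α = β then pv G α.src else 0 := by
  rw [uPath_eq_uList, uPath_eq_uList, star_uList_mul_uList (isPath_edges α) (isPath_edges β)
    (by rw [length_edges, length_edges])]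
  refine if_congr ⟨fun h => path_ext h.1 h.2, ?_⟩ rfl rfl
  rintro rfl
  exact ⟨rfl, rfl⟩

theorem star_uPath_mul_self {k : ℕ} (α : G.Path k) : star (uPath α) * uPath α = pv G α.src := by
  rw [star_uPath_mul_uPath, if_pos rfl]

theorem star_uPath_mul_of_ne {k : ℕ} {α β : G.Path k} (h : α ≠ β) :
    star (uPath α) * uPath β = 0 := by
  rw [star_uPath_mul_uPath, if_neg h]

theorem uPath_append {j k : ℕ} (α : G.Path j) (β : G.Path k) (h : α.src = β.rng) :
    uPath (α.append β h) = uPath α * uPath β := by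
  rw [uPath_eq_uList, uPath_eq_uList, uPath_eq_uList, ← h]
  exact uList_append (isPath_edges α) β.edges

theorem uPath_mul_uPath_of_ne {j k : ℕ} {α : G.Path j} {β : G.Path k} (h : α.src ≠ β.rng) :
    uPath α * uPath β = 0 := by
  rw [← uPath_mul_pv α, ← pv_mul_uPath β, mul_assoc, ← mul_assoc (pv G α.src), pv_mul_pv, if_neg h,
    zero_mul, mul_zero]

theorem uPath_eq_initial_mul_final {j k : ℕ} (α : G.Path (j + k)) :
    uPath α = uPath α.initial * uPath α.final := by
  rw [uPath_eq_uList, uPath_eq_uList, uPath_eq_uList]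
  have h := uList_append (isPath_edges α.initial) α.final.edges
  have h2 : α.initial.edges ++ α.final.edges = α.edges := List.take_append_drop j α.edges
  rw [h2] at h
  exact h

theorem uPath_edgePath (e : E) : uPath (edgePath G e) = u G e := by
  change ([e].map (u G)).prod = _
  simp

theorem uPath_eq_head_mul_tail {k : ℕ} (α : G.Path (k + 1)) :
    uPath α = u G α.head * uPath α.tail := by
  rw [uPath_eq_uList, uPath_eq_uList]
  obtain ⟨⟨v, l⟩, h, hl⟩ := α
  cases l with
  | nil => simp at hl
  | cons e l => exact uList_cons h.1 l

theorem u_mul_uPath_of_ne {k : ℕ} {e : E} {β : G.Path k} (h : G.s e ≠ β.rng) :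
    u G e * uPath β = 0 := by
  rw [← uPath_edgePath]
  exact uPath_mul_uPath_of_ne h

/-- Inserting the identity for length `k` between `u_e` and `u_e^*` gives a sum over pairs `(e, β)`.
-/
theorem sum_uPath_mul_star (k : ℕ) : ∑ α : G.Path k, uPath α * star (uPath α) = 1 := by
  classical
  induction k with
  | zero =>
    rw [← sum_pv]
    refine Fintype.sum_bijective (fun α : G.Path 0 => α.rng) ⟨?_, ?_⟩ _ _ ?_
    · intro α β h
      refine path_ext h ?_
      rw [List.length_eq_zero_iff.1 (length_edges α), List.length_eq_zero_iff.1 (length_edges β)]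
    · exact fun v => ⟨⟨(v, []), trivial, rfl⟩, rfl⟩
    · intro α
      rw [uPath_eq_uList, List.length_eq_zero_iff.1 (length_edges α), uList_nil, star_pv,
        pv_mul_self]
  | succ k ih =>
    have h1 : ∑ x : E × G.Path k, u G x.1 * uPath x.2 * star (u G x.1 * uPath x.2) = 1 := by
      rw [Fintype.sum_prod_type, ← sum_u_mul_star_u]
      refine Finset.sum_congr rfl fun e _ => ?_
      simp only [star_mul, mul_assoc]
      rw [← Finset.mul_sum]
      simp only [← mul_assoc]
      rw [← Finset.sum_mul, ih, one_mul]
    rw [← h1]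
    -- Paths of length `k + 1` correspond to the composable pairs; the other pairs contribute `0`.
    refine Finset.sum_of_injOn (fun α : G.Path (k + 1) => (α.head, α.tail)) ?_ ?_ ?_ ?_
    · intro α _ β _ h
      simp only [Prod.mk.injEq] at h
      exact DirGraph.Path.head_tail_injective h.1 h.2
    · intro α _
      simp
    · rintro ⟨e, β⟩ - h
      have h2 : G.s e ≠ β.rng := by
        intro h2
        refine h ⟨consPath e β h2, by simp, Prod.ext rfl ?_⟩
        exact path_ext h2 rfl
      rw [u_mul_uPath_of_ne h2, zero_mul]
    · intro α _
      rw [uPath_eq_head_mul_tail]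

theorem eq_zero_of_mul_uPath (k : ℕ) {x : LK G} (h : ∀ α : G.Path k, x * uPath α = 0) : x = 0 := by
  rw [← mul_one x, ← sum_uPath_mul_star k, Finset.mul_sum]
  exact Finset.sum_eq_zero fun α _ => by rw [← mul_assoc, h, zero_mul]

theorem eq_zero_of_star_uPath_mul (k : ℕ) {x : LK G} (h : ∀ α : G.Path k, star (uPath α) * x = 0) :
    x = 0 := by
  rw [← one_mul x, ← sum_uPath_mul_star k, Finset.sum_mul]
  exact Finset.sum_eq_zero fun α _ => by rw [mul_assoc, h, mul_zero]

/-! ### Commutation of the weight with paths of length `p` -/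

/-- Under condition A(p), the weight commutes with `u_α` for the paths `α` of length `p`. -/
theorem z_mul_uPath {W : WeightSequence G} {p : ℕ} (hA : ConditionA W p) (α : G.Path p) :
    W.z * uPath α = uPath α * W.z := by
  have hp := length_edges α
  have h : W.z * q G (SProd α.edges) = q G (SProd α.edges) * W.z := by
    rw [WeightSequence.z, ← map_mul, ← map_mul, ← sub_eq_zero, ← map_sub, q_eq_zero_iff]
    exact commutator_mem_K W _ (by rwa [hp])
  have h2 : q G (SProd α.edges) = (α.edges.map (u G)).prod := by
    rw [SProd, map_list_prod, List.map_map]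
    rfl
  rw [h2] at h
  rw [uPath_eq_uList, uList, ← mul_assoc, z_mul_pv, mul_assoc, h, mul_assoc]

theorem commute_z_pow_uPath {W : WeightSequence G} {p : ℕ} (hA : ConditionA W p) (l : ℕ)
    (α : G.Path p) : W.z ^ l * uPath α = uPath α * W.z ^ l :=
  (Commute.pow_left (show Commute W.z (uPath α) from z_mul_uPath hA α) l)

/-- Under condition A(p), the powers of the weight are diagonal with respect to the paths of any
length up to `p`. -/
theorem star_uPath_mul_z_pow_mul_uPath {W : WeightSequence G} {p : ℕ} (hA : ConditionA W p)
    {j : ℕ} (hj : j ≤ p) (l : ℕ) {α β : G.Path j} (h : α ≠ β) :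
    star (uPath α) * W.z ^ l * uPath β = 0 := by
  obtain ⟨i, rfl⟩ := Nat.exists_eq_add_of_le hj
  -- Lengthen both paths by `i = p - j` edges. At length `p` the weight moves past `u`, and
  -- extensions of distinct paths stay distinct, hence orthogonal.
  refine eq_zero_of_mul_uPath i fun γ => eq_zero_of_star_uPath_mul i fun δ => ?_
  have h1 : star (uPath δ) * (star (uPath α) * W.z ^ l * uPath β * uPath γ) =
      star (uPath α * uPath δ) * W.z ^ l * (uPath β * uPath γ) := by
    simp only [star_mul, mul_assoc]
  rw [h1]
  by_cases hδ : α.src = δ.rng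
  · by_cases hγ : β.src = γ.rng
    · rw [← uPath_append _ _ hδ, ← uPath_append _ _ hγ, mul_assoc, commute_z_pow_uPath hA,
        ← mul_assoc, star_uPath_mul_of_ne, zero_mul]
      intro h2
      refine h (path_ext ?_ ?_)
      · exact congrArg (fun x : G.Path (j + i) => x.rng) h2
      · have h3 := congrArg (fun x : G.Path (j + i) => x.edges.take j) h2
        change List.take j (α.edges ++ _) = List.take j (β.edges ++ _) at h3
        rwa [List.take_left' (length_edges α), List.take_left' (length_edges β)] at h3
    · rw [uPath_mul_uPath_of_ne hγ, mul_zero]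
  · rw [uPath_mul_uPath_of_ne hδ, star_zero, zero_mul, zero_mul]

end

section

variable {V E : Type*} {G : DirGraph V E} [Fintype V] [Fintype E]

/-! ### Cancellation rules -/

section Cancellation

variable {j k : ℕ} {α : G.Path j} {β : G.Path k}

/-- These rules hold for two paths of different lengths, since only the source projection survives
in the middle. The `_assoc` forms serve `simp` on right-associated products. -/
theorem uPath_mul_cancel (h : α.src = β.src) :
    uPath α * (star (uPath β) * uPath β) = uPath α := by
  rw [star_uPath_mul_self, ← h, uPath_mul_pv]

theorem uPath_mul_cancel_assoc (h : α.src = β.src) (x : LK G) :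
    uPath α * (star (uPath β) * (uPath β * x)) = uPath α * x := by
  rw [← mul_assoc (star _), ← mul_assoc (uPath α), uPath_mul_cancel h]

theorem cancel_mul_star_uPath (h : α.src = β.src) :
    star (uPath β) * (uPath β * star (uPath α)) = star (uPath α) := by
  rw [← star_star (uPath β), ← star_mul, star_star, ← star_mul, mul_assoc, uPath_mul_cancel h]

theorem cancel_mul_star_uPath_assoc (h : α.src = β.src) (x : LK G) :
    star (uPath β) * (uPath β * (star (uPath α) * x)) = star (uPath α) * x := by
  rw [← mul_assoc (uPath β), ← mul_assoc (star (uPath β)), cancel_mul_star_uPath h]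

theorem cancel_mul_uPath (h : α.src = β.rng) :
    star (uPath α) * (uPath α * uPath β) = uPath β := by
  rw [← mul_assoc, star_uPath_mul_self, h, pv_mul_uPath]

end Cancellation

/-- A product is expanded like a matrix product, so that properties of the entries of `x` and `y`
pass to those of `x * y`. -/
theorem mul_eq_sum_uPath (k : ℕ) (x y : LK G) :
    x * y = ∑ α : G.Path k, x * uPath α * (star (uPath α) * y) := by
  calc x * y = x * (∑ α : G.Path k, uPath α * star (uPath α)) * y := by
        rw [sum_uPath_mul_star, mul_one]
    _ = _ := by simp only [Finset.mul_sum, Finset.sum_mul, mul_assoc]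

theorem mul_eq_sum_uPath_mul_u (k : ℕ) (x y : LK G) :
    x * y = ∑ α : G.Path k, ∑ e, x * (uPath α * u G e) * (star (uPath α * u G e) * y) := by
  rw [mul_eq_sum_uPath k]
  refine Finset.sum_congr rfl fun α _ => ?_
  calc x * uPath α * (star (uPath α) * y)
      = x * uPath α * (∑ e, u G e * star (u G e)) * (star (uPath α) * y) := by
        rw [sum_u_mul_star_u, mul_one]
    _ = _ := by simp only [Finset.mul_sum, Finset.sum_mul, star_mul, mul_assoc]

/-- The product `u_α^* u_μ`, for a path `μ` that starts with `α`. -/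
theorem star_uPath_mul_uPath_add {k j : ℕ} (α : G.Path k) (μ : G.Path (k + j)) :
    star (uPath α) * uPath μ = 0 ∨
      (μ.final.rng = α.src ∧ star (uPath α) * uPath μ = uPath μ.final) := by
  by_cases h : α = μ.initial
  · subst h
    refine Or.inr ⟨rfl, ?_⟩
    rw [uPath_eq_initial_mul_final, cancel_mul_uPath rfl]
  · left
    rw [uPath_eq_initial_mul_final, ← mul_assoc, star_uPath_mul_of_ne h, zero_mul]

/-! ### The algebras `C_n` -/

theorem isClosed_C (W : WeightSequence G) (p n : ℕ) : IsClosed (C W p n : Set (LK G)) := by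
  rw [C, generatedCStar, NonUnitalStarAlgebra.coe_sInf]
  exact isClosed_biInter fun S hS => hS.1

theorem generator_mem_C (W : WeightSequence G) {p n k : ℕ} (h1 : n * p ≤ k) (h2 : k < (n + 1) * p)
    (l : ℕ) {α β : G.Path k} (h : α.src = β.src) :
    uPath α * W.z ^ l * star (uPath β) ∈ C W p n := by
  rw [C, generatedCStar, NonUnitalStarAlgebra.mem_sInf]
  exact fun S hS => hS.2 ⟨l, k, α, β, h1, h2, h, rfl⟩

theorem uPath_mul_star_mem_C (W : WeightSequence G) {p n k : ℕ} (h1 : n * p ≤ k)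
    (h2 : k < (n + 1) * p) {α β : G.Path k} (h : α.src = β.src) :
    uPath α * star (uPath β) ∈ C W p n := by
  simpa using generator_mem_C W h1 h2 0 h

/-- The induction principle for `C_n`: a property defining a closed `*`-subalgebra need only be
checked on generators. -/
theorem C_le {W : WeightSequence G} {p n : ℕ} {B : NonUnitalStarSubalgebra ℂ (LK G)}
    (hB : IsClosed (B : Set (LK G)))
    (h : ∀ (l k : ℕ) (α β : G.Path k), n * p ≤ k → k < (n + 1) * p → α.src = β.src →
      uPath α * W.z ^ l * star (uPath β) ∈ B) : C W p n ≤ B := by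
  refine sInf_le ⟨hB, ?_⟩
  rintro x ⟨l, k, α, β, h1, h2, h3, rfl⟩
  exact h l k α β h1 h2 h3

/-- Unless the product is `0`, the generator cancels the first `k` edges of `μ₁` and `μ₂` and leaves
tails of length `j`. Prefixing both tails with one path `ζ` of length `i` writes the result as a
product of three elements of `C_n`, the middle one being `u_ζ z^l u_ζ^*`. -/
theorem transfer_generator_mem (hG : G.NoSinks) (W : WeightSequence G) {p n i j k : ℕ}
    (hi : n * p ≤ i) (hij : i + j < (n + 1) * p) (l : ℕ) {α β : G.Path k} (h : α.src = β.src)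
    (μ₁ μ₂ : G.Path (k + j)) {ν₁ ν₂ : G.Path (i + j)} (h₁ : ν₁.src = μ₁.src)
    (h₂ : ν₂.src = μ₂.src) :
    uPath ν₁ * star (uPath μ₁) * (uPath α * W.z ^ l * star (uPath β)) * uPath μ₂ *
      star (uPath ν₂) ∈ C W p n := by
  have h1 : uPath ν₁ * star (uPath μ₁) * (uPath α * W.z ^ l * star (uPath β)) * uPath μ₂ *
      star (uPath ν₂) = uPath ν₁ * (star (star (uPath α) * uPath μ₁) * W.z ^ l *
        (star (uPath β) * uPath μ₂)) * star (uPath ν₂) := by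
    simp only [star_mul, star_star, mul_assoc]
  rw [h1]
  rcases star_uPath_mul_uPath_add α μ₁ with h2 | ⟨h2, h2'⟩
  · simp only [h2, star_zero, zero_mul, mul_zero, zero_mem]
  rcases star_uPath_mul_uPath_add β μ₂ with h3 | ⟨h3, h3'⟩
  · simp only [h3, zero_mul, mul_zero, zero_mem]
  rw [h2', h3']
  obtain ⟨ζ, hζ⟩ := exists_path_src_eq hG i α.src
  have hζ1 : ζ.src = μ₁.final.rng := hζ.trans h2.symm
  have hζ2 : ζ.src = μ₂.final.rng := (hζ.trans h).trans h3.symm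
  have m1 : uPath ν₁ * star (uPath (ζ.append μ₁.final hζ1)) ∈ C W p n := by
    refine uPath_mul_star_mem_C W (by omega) hij ?_
    rw [src_append, src_final, h₁]
  have m2 : uPath (ζ.append μ₂.final hζ2) * star (uPath ν₂) ∈ C W p n := by
    refine uPath_mul_star_mem_C W (by omega) hij ?_
    rw [src_append, src_final, h₂]
  have m3 : uPath ζ * W.z ^ l * star (uPath ζ) ∈ C W p n :=
    generator_mem_C W hi (by omega) l rfl
  convert mul_mem (mul_mem m1 m3) m2 using 1
  have h4 := cancel_mul_uPath hζ1
  have h5 := cancel_mul_uPath hζ2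
  rw [uPath_append, uPath_append]
  conv_lhs => rw [← h4, ← h5]
  simp only [star_mul, star_star, mul_assoc]

/-- Replacing paths of length `np + p - 1` by paths of length `n'p + p - 1` with the same sources
maps `C_n` to `C_{n'}`. -/
theorem transfer_mem (hG : G.NoSinks) {W : WeightSequence G} {p n n' m m' : ℕ} (hp : 1 ≤ p)
    (hm : m = n * p + (p - 1)) (hm' : m' = n' * p + (p - 1)) {c : LK G} (hc : c ∈ C W p n)
    {μ₁ μ₂ : G.Path m} {ν₁ ν₂ : G.Path m'} (h₁ : ν₁.src = μ₁.src) (h₂ : ν₂.src = μ₂.src) :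
    uPath ν₁ * star (uPath μ₁) * c * uPath μ₂ * star (uPath ν₂) ∈ C W p n' := by
  -- Quantifying over all four paths makes the property multiplicative: the product is expanded over
  -- paths `μ`, and each `μ` is paired with some `ν` having the same source.
  let B : NonUnitalStarSubalgebra ℂ (LK G) :=
    { carrier := {c | ∀ (μ₁ μ₂ : G.Path m) (ν₁ ν₂ : G.Path m'), ν₁.src = μ₁.src →
        ν₂.src = μ₂.src →
        uPath ν₁ * star (uPath μ₁) * c * uPath μ₂ * star (uPath ν₂) ∈ C W p n'}
      add_mem' := by
        intro a b ha hb μ₁ μ₂ ν₁ ν₂ h₁ h₂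
        simpa only [mul_add, add_mul] using add_mem (ha μ₁ μ₂ ν₁ ν₂ h₁ h₂) (hb μ₁ μ₂ ν₁ ν₂ h₁ h₂)
      zero_mem' := by
        intro μ₁ μ₂ ν₁ ν₂ _ _
        simp only [mul_zero, zero_mul, zero_mem]
      mul_mem' := by
        intro a b ha hb μ₁ μ₂ ν₁ ν₂ h₁ h₂
        rw [mul_eq_sum_uPath m a b, Finset.mul_sum, Finset.sum_mul, Finset.sum_mul]
        refine sum_mem fun μ _ => ?_
        obtain ⟨ν, hν⟩ := exists_path_src_eq hG m' μ.src
        convert mul_mem (ha μ₁ μ ν₁ ν h₁ hν) (hb μ μ₂ ν ν₂ hν h₂) using 1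
        simp only [mul_assoc, uPath_mul_cancel_assoc hν.symm]
      smul_mem' := by
        intro t a ha μ₁ μ₂ ν₁ ν₂ h₁ h₂
        simpa only [mul_smul_comm, smul_mul_assoc] using
          SMulMemClass.smul_mem t (ha μ₁ μ₂ ν₁ ν₂ h₁ h₂)
      star_mem' := by
        intro a ha μ₁ μ₂ ν₁ ν₂ h₁ h₂
        simpa only [star_mul, star_star, mul_assoc] using star_mem (ha μ₂ μ₁ ν₂ ν₁ h₂ h₁) }
  have hB : IsClosed (B : Set (LK G)) := by
    have : (B : Set (LK G)) = ⋂ (μ₁ : G.Path m) (μ₂ : G.Path m) (ν₁ : G.Path m') (ν₂ : G.Path m')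
        (_ : ν₁.src = μ₁.src) (_ : ν₂.src = μ₂.src),
        (fun c => uPath ν₁ * star (uPath μ₁) * c * (uPath μ₂ * star (uPath ν₂))) ⁻¹'
          (C W p n' : Set (LK G)) := by
      ext c
      simp only [Set.mem_iInter, Set.mem_preimage, ← mul_assoc]
      rfl
    rw [this]
    refine isClosed_iInter fun _ => isClosed_iInter fun _ => isClosed_iInter fun _ =>
      isClosed_iInter fun _ => isClosed_iInter fun _ => isClosed_iInter fun _ => ?_
    exact (isClosed_C W p n').preimage (continuous_mul_mul _ _)
  refine C_le hB ?_ hc μ₁ μ₂ ν₁ ν₂ h₁ h₂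
  intro l k α β hk1 hk2 h μ₁ μ₂ ν₁ ν₂ h₁ h₂
  rw [add_mul, one_mul] at hk2
  -- Both lengths exceed those of the generator paths by the same `j`, so `i - n'p = k - np` and `i`
  -- lies in the range allowed for `C_{n'}`.
  obtain ⟨j, rfl⟩ : ∃ j, m = k + j := ⟨m - k, by omega⟩
  obtain ⟨i, rfl⟩ : ∃ i, m' = i + j := ⟨m' - j, by omega⟩
  exact transfer_generator_mem hG W (by omega) (by rw [add_mul, one_mul]; omega) l h μ₁ μ₂ h₁ h₂

/-- After cancellation of `α` and `β`, paths of length `j + 1 ≤ p` with distinct last edges face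
each other across `z^l`. -/
theorem generator_diagonal {W : WeightSequence G} {p j k : ℕ} (hA : ConditionA W p) (hj : j < p)
    (l : ℕ) (α β : G.Path k) (μ₁ μ₂ : G.Path (k + j)) {e f : E} (hef : e ≠ f) :
    star (uPath μ₁ * u G e) * (uPath α * W.z ^ l * star (uPath β)) * (uPath μ₂ * u G f) = 0 := by
  have h1 : star (uPath μ₁ * u G e) * (uPath α * W.z ^ l * star (uPath β)) * (uPath μ₂ * u G f) =
      star (star (uPath α) * uPath μ₁ * u G e) * W.z ^ l *
        (star (uPath β) * uPath μ₂ * u G f) := by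
    simp only [star_mul, star_star, mul_assoc]
  rw [h1]
  rcases star_uPath_mul_uPath_add α μ₁ with h2 | ⟨-, h2⟩
  · simp only [h2, star_zero, zero_mul]
  rcases star_uPath_mul_uPath_add β μ₂ with h3 | ⟨-, h3⟩
  · simp only [h3, zero_mul, mul_zero]
  rw [h2, h3, ← uPath_edgePath, ← uPath_edgePath]
  by_cases he : μ₁.final.src = (edgePath G e).rng
  · by_cases hf : μ₂.final.src = (edgePath G f).rng
    · rw [← uPath_append _ _ he, ← uPath_append _ _ hf]
      refine star_uPath_mul_z_pow_mul_uPath hA hj l fun h => hef ?_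
      have h4 := congrArg (fun x : G.Path (j + 1) => x.edges.drop j) h
      change List.drop j (μ₁.final.edges ++ [e]) = List.drop j (μ₂.final.edges ++ [f]) at h4
      rw [List.drop_left' (length_edges _), List.drop_left' (length_edges _)] at h4
      simpa using h4
    · rw [uPath_mul_uPath_of_ne hf, mul_zero]
  · rw [uPath_mul_uPath_of_ne he, star_zero, zero_mul, zero_mul]

/-- Under condition A(p), the elements of `C_n` are diagonal in the last edge of the paths of
length `(n + 1)p`. -/
theorem star_mul_mem_C_mul_eq_zero {W : WeightSequence G} {p n m : ℕ} (hA : ConditionA W p)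
    (hm : m + 1 = (n + 1) * p) {c : LK G} (hc : c ∈ C W p n) (μ₁ μ₂ : G.Path m) {e f : E}
    (hef : e ≠ f) : star (uPath μ₁ * u G e) * c * (uPath μ₂ * u G f) = 0 := by
  let B : NonUnitalStarSubalgebra ℂ (LK G) :=
    { carrier := {c | ∀ (μ₁ μ₂ : G.Path m) (e f : E), e ≠ f →
        star (uPath μ₁ * u G e) * c * (uPath μ₂ * u G f) = 0}
      add_mem' := by
        intro a b ha hb μ₁ μ₂ e f h
        rw [mul_add, add_mul, ha μ₁ μ₂ e f h, hb μ₁ μ₂ e f h, add_zero]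
      zero_mem' := by
        intro μ₁ μ₂ e f _
        rw [mul_zero, zero_mul]
      mul_mem' := by
        intro a b ha hb μ₁ μ₂ e f h
        rw [mul_eq_sum_uPath_mul_u m a b]
        simp only [Finset.mul_sum, Finset.sum_mul]
        refine Finset.sum_eq_zero fun μ _ => Finset.sum_eq_zero fun g _ => ?_
        have h1 : star (uPath μ₁ * u G e) * (a * (uPath μ * u G g) *
            (star (uPath μ * u G g) * b)) * (uPath μ₂ * u G f) =
            star (uPath μ₁ * u G e) * a * (uPath μ * u G g) *
              (star (uPath μ * u G g) * b * (uPath μ₂ * u G f)) := by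
          simp only [mul_assoc]
        rw [h1]
        -- The intermediate last edge `g` cannot equal both `e` and `f`, so one of the two factors
        -- vanishes.
        by_cases hg : e = g
        · rw [hb μ μ₂ g f (hg ▸ h), mul_zero]
        · rw [ha μ₁ μ e g hg, zero_mul]
      smul_mem' := by
        intro t a ha μ₁ μ₂ e f h
        rw [mul_smul_comm, smul_mul_assoc, ha μ₁ μ₂ e f h, smul_zero]
      star_mem' := by
        intro a ha μ₁ μ₂ e f h
        have := congrArg star (ha μ₂ μ₁ f e h.symm)
        simpa only [star_mul, star_star, star_zero, mul_assoc] using this }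
  have hB : IsClosed (B : Set (LK G)) := by
    have : (B : Set (LK G)) = ⋂ (μ₁ : G.Path m) (μ₂ : G.Path m) (e : E) (f : E) (_ : e ≠ f),
        (fun c => star (uPath μ₁ * u G e) * c * (uPath μ₂ * u G f)) ⁻¹' {0} := by
      ext c
      simp only [Set.mem_iInter, Set.mem_preimage]
      rfl
    rw [this]
    refine isClosed_iInter fun _ => isClosed_iInter fun _ => isClosed_iInter fun _ =>
      isClosed_iInter fun _ => isClosed_iInter fun _ => ?_
    exact isClosed_singleton_zero.preimage (continuous_mul_mul _ _)
  refine C_le hB ?_ hc μ₁ μ₂ e f hef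
  intro l k α β hk1 hk2 h μ₁ μ₂ e f hef
  rw [add_mul, one_mul] at hk2 hm
  obtain ⟨j, rfl⟩ : ∃ j, m = k + j := ⟨m - k, by omega⟩
  exact generator_diagonal hA (by omega) l α β μ₁ μ₂ hef

/-! ### Corner ideals -/

/-- `x ↦ a x b` as a linear map. -/
def sandwich (a b : LK G) : LK G →ₗ[ℂ] LK G := LinearMap.mulRight ℂ b ∘ₗ LinearMap.mulLeft ℂ a

theorem sandwich_apply (a b x : LK G) : sandwich a b x = a * x * b := rfl

/-- The path `μe` of length `m + 1` is regrouped as `gν`, with its first edge split off. -/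
theorem exists_uPath_mul_u_eq {m : ℕ} (μ : G.Path m) {e : E} (h : μ.src = G.r e) :
    ∃ (g : E) (ν : G.Path m), ν.src = G.s e ∧ uPath μ * u G e = u G g * uPath ν := by
  have h' : μ.src = (edgePath G e).rng := h
  refine ⟨(μ.append _ h').head, (μ.append _ h').tail, ?_, ?_⟩
  · rw [DirGraph.Path.src_tail, src_append, src_edgePath]
  · rw [← uPath_eq_head_mul_tail, uPath_append, uPath_edgePath]

/-- The opposite regrouping: `eμ` becomes `νg`, with the last edge split off. -/
theorem exists_u_mul_uPath_eq {m : ℕ} (μ : G.Path m) {e : E} (h : G.s e = μ.rng) :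
    ∃ (ν : G.Path m) (g : E), ν.src = G.r g ∧ G.s g = μ.src ∧
      u G e * uPath μ = uPath ν * u G g := by
  obtain ⟨g, hg⟩ := exists_eq_edgePath (consPath e μ h).final
  refine ⟨(consPath e μ h).initial, g, ?_, ?_, ?_⟩
  · rw [src_initial, hg, rng_edgePath]
  · rw [← src_edgePath, ← hg, src_final, ← DirGraph.Path.src_tail]
    congr 1
    exact path_ext h rfl
  · rw [← uPath_edgePath g, ← hg, ← uPath_eq_initial_mul_final, uPath_eq_head_mul_tail]
    congr 2
    exact path_ext h.symm rfl

end

section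

variable {V E : Type*} {G : DirGraph V E} [Fintype V] [Fintype E]

section CornerIdeals

variable {W : WeightSequence G} {p n m : ℕ} {J : Submodule ℂ (LK G)}

theorem length_bounds (hp : 1 ≤ p) (hm : m = n * p + (p - 1)) : n * p ≤ m ∧ m < (n + 1) * p := by
  rw [add_mul, one_mul]
  omega

/-- An ideal of `C_n` is stable under the replacement of paths of length `np + p - 1` by paths of
the same length with the same sources. -/
theorem replace_mem (hp : 1 ≤ p) (hm : m = n * p + (p - 1))
    (hJ : IsIdealOf (C W p n : Set (LK G)) J) {x : LK G} (hx : x ∈ J) {μ₁ μ₂ ν₁ ν₂ : G.Path m}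
    (h₁ : ν₁.src = μ₁.src) (h₂ : ν₂.src = μ₂.src) :
    uPath ν₁ * star (uPath μ₁) * x * (uPath μ₂ * star (uPath ν₂)) ∈ J := by
  obtain ⟨hb1, hb2⟩ := length_bounds (n := n) hp hm
  exact (hJ.2 _ (uPath_mul_star_mem_C W hb1 hb2 h₂.symm) _
    (hJ.2 _ (uPath_mul_star_mem_C W hb1 hb2 h₁) _ hx).1).2

/-- The corner `u_{ξ_v} u_{μ₁}^* J u_{μ₂} u_{ξ_v}^*` does not depend on the paths `μ₁, μ₂` with
source `v`. -/
theorem corner_image_subset (hp : 1 ≤ p) (hm : m = n * p + (p - 1))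
    (hJ : IsIdealOf (C W p n : Set (LK G)) J) {μ₁ μ₂ ν₁ ν₂ : G.Path m}
    (h₁ : ν₁.src = μ₁.src) (h₂ : ν₂.src = μ₂.src) (a b : LK G) :
    (fun x => a * star (uPath μ₁) * x * uPath μ₂ * b) '' (J : Set (LK G)) ⊆
      (fun x => a * star (uPath ν₁) * x * uPath ν₂ * b) '' (J : Set (LK G)) := by
  rintro _ ⟨x, hx, rfl⟩
  refine ⟨_, replace_mem hp hm hJ hx h₁ h₂, ?_⟩
  simp only [mul_assoc, uPath_mul_cancel_assoc h₂.symm, cancel_mul_star_uPath_assoc h₁.symm]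

/-- Both inclusions come from `transfer_mem`, used from level `n` to level `0` for containment in
`C_v` and in the other direction for the ideal property. -/
theorem isIdealOf_corner (hG : G.NoSinks) (hp : 1 ≤ p) (hm : m = n * p + (p - 1))
    (hJ : IsIdealOf (C W p n : Set (LK G)) J) {ξ : V → G.Path (p - 1)} {v : V}
    (hξ : (ξ v).src = v) {μ : G.Path m} (hμ : μ.src = v) :
    IsIdealOf (Cv W p ξ v)
      (J.map (sandwich (uPath (ξ v) * star (uPath μ)) (uPath μ * star (uPath (ξ v))))) := by
  have h : (ξ v).src = μ.src := hξ.trans hμ.symm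
  have h0 : p - 1 = 0 * p + (p - 1) := by omega
  refine ⟨?_, ?_⟩
  · rintro _ ⟨x, hx, rfl⟩
    refine ⟨_, transfer_mem hG hp hm h0 (hJ.1 hx) h h, ?_⟩
    simp only [sandwich_apply, mul_assoc, uPath_mul_cancel_assoc rfl, cancel_mul_star_uPath rfl]
  · rintro _ ⟨c, hc, rfl⟩ _ ⟨x, hx, rfl⟩
    -- Multiplying the corner of `x` by the compression of `c` gives the corner of the product of
    -- `x` with this transported copy of `c` in `C_n`.
    have hc' := transfer_mem hG hp h0 hm hc h.symm h.symm
    refine ⟨⟨_, (hJ.2 _ hc' x hx).1, ?_⟩, ⟨_, (hJ.2 _ hc' x hx).2, ?_⟩⟩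
    · simp only [sandwich_apply, mul_assoc, uPath_mul_cancel_assoc rfl,
        cancel_mul_star_uPath_assoc h]
    · simp only [sandwich_apply, mul_assoc, cancel_mul_star_uPath_assoc rfl,
        cancel_mul_star_uPath h]

open Classical in
/-- The matrices with entries in the corners are the values of `τ_n` on the ideal. -/
theorem exists_tau_eq (hp : 1 ≤ p) (hJ : IsIdealOf (C W p n : Set (LK G)) J)
    {ξ : V → G.Path (p - 1)}
    {M : Matrix (G.Path (n * p + (p - 1))) (G.Path (n * p + (p - 1))) (LK G)}
    (hM : ∀ μ₁ μ₂, μ₁.src = μ₂.src → ∃ x ∈ J, uPath (ξ μ₁.src) * star (uPath μ₁) * x * uPath μ₂ *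
      star (uPath (ξ μ₁.src)) = M μ₁ μ₂)
    (hM0 : ∀ μ₁ μ₂, μ₁.src ≠ μ₂.src → M μ₁ μ₂ = 0) : ∃ x ∈ J, tau ξ n x = M := by
  choose! X hXJ hX using hM
  -- Each entry is lifted to `X μ₁ μ₂` in `J` and cut down by `u_{μ₁} u_{μ₁}^*` and `u_{μ₂}
  -- u_{μ₂}^*`; by orthogonality `τ_n` then sees each lift only at its own entry.
  refine ⟨∑ μ₁ : G.Path (n * p + (p - 1)), ∑ μ₂ : G.Path (n * p + (p - 1)),
    if μ₁.src = μ₂.src then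
      uPath μ₁ * star (uPath μ₁) * X μ₁ μ₂ * (uPath μ₂ * star (uPath μ₂)) else 0, ?_, ?_⟩
  · refine sum_mem fun μ₁ _ => sum_mem fun μ₂ _ => ?_
    split_ifs with h
    · exact replace_mem hp rfl hJ (hXJ μ₁ μ₂ h) rfl rfl
    · exact zero_mem J
  · ext ν₁ ν₂
    rw [tau, Matrix.of_apply]
    split_ifs with h
    · simp only [Finset.mul_sum, Finset.sum_mul]
      rw [Finset.sum_eq_single ν₁, Finset.sum_eq_single ν₂, if_pos h, ← hX ν₁ ν₂ h, ← h]
      · simp only [mul_assoc, uPath_mul_cancel_assoc rfl, cancel_mul_star_uPath_assoc rfl]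
      · intro μ₂ _ hμ
        split_ifs
        · have := star_uPath_mul_of_ne hμ
          simp only [mul_assoc]
          rw [← mul_assoc (star (uPath μ₂)) (uPath ν₂), this]
          simp only [zero_mul, mul_zero]
        · simp only [zero_mul, mul_zero]
      · simp
      · intro μ₁ _ hμ
        refine Finset.sum_eq_zero fun μ₂ _ => ?_
        split_ifs
        · have := star_uPath_mul_of_ne hμ.symm
          simp only [mul_assoc]
          rw [← mul_assoc (star (uPath ν₁)) (uPath μ₁), this]
          simp only [zero_mul, mul_zero]
        · simp only [zero_mul, mul_zero]
      · simp
    · exact (hM0 ν₁ ν₂ h).symm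

/-- The corners are built with one chosen path `μ v` per vertex, which exists because there are no
sinks. Uniqueness follows from the third condition at these paths. -/
theorem existsUnique_isCornerFamily (hG : G.NoSinks) (hp : 1 ≤ p)
    (hJ : IsIdealOf (C W p n : Set (LK G)) J) {ξ : V → G.Path (p - 1)}
    (hξ : ∀ v, (ξ v).src = v) :
    ∃! Jv : V → Submodule ℂ (LK G), IsCornerFamily W p n ξ J Jv := by
  classical
  choose μ hμ using exists_path_src_eq hG (n * p + (p - 1))
  let Jv : V → Submodule ℂ (LK G) := fun v =>
    J.map (sandwich (uPath (ξ v) * star (uPath (μ v))) (uPath (μ v) * star (uPath (ξ v))))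
  have hJv : ∀ v, (Jv v : Set (LK G)) = (fun x => uPath (ξ v) * star (uPath (μ v)) * x *
      uPath (μ v) * star (uPath (ξ v))) '' (J : Set (LK G)) := by
    intro v
    rw [Submodule.map_coe]
    refine Set.image_congr fun x _ => ?_
    rw [sandwich_apply, ← mul_assoc]
  have hcorner : ∀ (v : V) (μ₁ μ₂ : G.Path (n * p + (p - 1))), μ₁.src = v → μ₂.src = v →
      (Jv v : Set (LK G)) = (fun x => uPath (ξ v) * star (uPath μ₁) * x * uPath μ₂ *
        star (uPath (ξ v))) '' (J : Set (LK G)) := by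
    intro v μ₁ μ₂ h₁ h₂
    rw [hJv]
    have h₁' := h₁.trans (hμ v).symm
    have h₂' := h₂.trans (hμ v).symm
    exact (corner_image_subset hp rfl hJ h₁' h₂' _ _).antisymm
      (corner_image_subset hp rfl hJ h₁'.symm h₂'.symm _ _)
  refine ⟨Jv, ⟨fun v => isIdealOf_corner hG hp rfl hJ (hξ v) (hμ v), ?_, hcorner⟩, ?_⟩
  · ext M
    constructor
    · rintro ⟨x, hx, rfl⟩ μ₁ μ₂
      refine ⟨fun h => ?_, fun h => ?_⟩
      · rw [tau, Matrix.of_apply, if_pos h, ← h, ← SetLike.mem_coe,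
          hcorner μ₁.src μ₁ μ₂ rfl h.symm]
        exact ⟨x, hx, rfl⟩
      · rw [tau, Matrix.of_apply, if_neg h]
    · intro hM
      refine exists_tau_eq hp hJ (fun μ₁ μ₂ h => ?_) fun μ₁ μ₂ h => (hM μ₁ μ₂).2 h
      have := (hM μ₁ μ₂).1 h
      rw [← SetLike.mem_coe, hcorner μ₁.src μ₁ μ₂ rfl h.symm] at this
      exact this
  · intro Jv' h'
    funext v
    exact SetLike.coe_injective
      ((h'.corner v (μ v) (μ v) (hμ v) (hμ v)).trans (hJv v).symm)

/-! ### The invariance criterion -/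

variable {ξ : V → G.Path (p - 1)} {Jv : V → Submodule ℂ (LK G)}

/-- The connecting paths `ξ` cancel, so `π(e,f)` lengthens the compressing paths by the last edges
`e` and `f`. -/
theorem piMap_corner (hξ : ∀ v, (ξ v).src = v) {e f : E} (hr : G.r e = G.r f) (hs : G.s e = G.s f)
    {ν₁ ν₂ : G.Path m} (h₁ : ν₁.src = G.r e) (h₂ : ν₂.src = G.r e) (x : LK G) :
    piMap ξ e f (uPath (ξ (G.r e)) * star (uPath ν₁) * x * uPath ν₂ * star (uPath (ξ (G.r e)))) =
      uPath (ξ (G.s e)) * star (uPath ν₁ * u G e) * x * (uPath ν₂ * u G f) *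
        star (uPath (ξ (G.s e))) := by
  have h₁' : ν₁.src = (ξ (G.r e)).src := h₁.trans (hξ _).symm
  have h₂' : ν₂.src = (ξ (G.r e)).src := h₂.trans (hξ _).symm
  rw [piMap, ← hr, ← hs]
  simp only [star_mul, mul_assoc, uPath_mul_cancel_assoc h₂', cancel_mul_star_uPath_assoc h₁']

/-- With `μe = g₁ν₁` and `μf = g₂ν₂`, the image under `π(e,f)` of the corner of `x` is the corner of
`u_{g₁}^* x u_{g₂}`, which lies in `J` by invariance. -/
theorem piMap_mem_of_isInvariant (hG : G.NoSinks) (hξ : ∀ v, (ξ v).src = v)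
    (h : IsCornerFamily W p n ξ J Jv) (hinv : IsInvariant J) {e f : E} (hr : G.r e = G.r f)
    (hs : G.s e = G.s f) {c : LK G} (hc : c ∈ Jv (G.r e)) : piMap ξ e f c ∈ Jv (G.s e) := by
  obtain ⟨μ, hμ⟩ := exists_path_src_eq hG (n * p + (p - 1)) (G.r e)
  rw [← SetLike.mem_coe, h.corner _ μ μ hμ hμ] at hc
  obtain ⟨x, hx, rfl⟩ := hc
  obtain ⟨g₁, ν₁, hν₁, hu₁⟩ := exists_uPath_mul_u_eq μ hμ
  obtain ⟨g₂, ν₂, hν₂, hu₂⟩ := exists_uPath_mul_u_eq μ (hμ.trans hr)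
  rw [← SetLike.mem_coe, h.corner _ ν₁ ν₂ hν₁ (hν₂.trans hs.symm)]
  refine ⟨_, hinv g₁ g₂ x hx, ?_⟩
  simp only
  rw [piMap_corner hξ hr hs hμ hμ, hu₁, hu₂]
  simp only [star_mul, mul_assoc]

/-- Only the maps `π(e,e)` are needed, because the entries of `u_e^* x u_f` that involve two
different last edges vanish under condition A(p). -/
theorem isInvariant_of_piMap_mem (hp : 1 ≤ p) (hA : ConditionA W p)
    (hJ : IsIdealOf (C W p n : Set (LK G)) J) (hξ : ∀ v, (ξ v).src = v)
    (h : IsCornerFamily W p n ξ J Jv)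
    (hpi : ∀ e, ∀ c ∈ Jv (G.r e), piMap ξ e e c ∈ Jv (G.s e)) : IsInvariant J := by
  intro e f x hx
  -- Cut `u_e^* x u_f` into its matrix entries over the paths of length `np + p - 1`; it suffices
  -- that each entry is in `J`.
  rw [← one_mul (star (u G e) * x * u G f), ← mul_one (1 * _),
    ← sum_uPath_mul_star (n * p + (p - 1))]
  simp only [Finset.mul_sum, Finset.sum_mul]
  refine sum_mem fun μ₂ _ => sum_mem fun μ₁ _ => ?_
  have h1 : uPath μ₁ * star (uPath μ₁) * (star (u G e) * x * u G f) *
      (uPath μ₂ * star (uPath μ₂)) = uPath μ₁ * (star (u G e * uPath μ₁) * x *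
        (u G f * uPath μ₂)) * star (uPath μ₂) := by
    simp only [star_mul, mul_assoc]
  rw [h1]
  by_cases he : G.s e = μ₁.rng
  swap
  · rw [u_mul_uPath_of_ne he]
    simp only [star_zero, zero_mul, mul_zero, zero_mem]
  by_cases hf : G.s f = μ₂.rng
  swap
  · rw [u_mul_uPath_of_ne hf]
    simp only [zero_mul, mul_zero, zero_mem]
  obtain ⟨ν₁, g₁, hν₁, hs₁, hu₁⟩ := exists_u_mul_uPath_eq μ₁ he
  obtain ⟨ν₂, g₂, hν₂, hs₂, hu₂⟩ := exists_u_mul_uPath_eq μ₂ hf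
  rw [hu₁, hu₂]
  by_cases hg : g₁ = g₂
  swap
  · rw [star_mul_mem_C_mul_eq_zero hA _ (hJ.1 hx) ν₁ ν₂ hg]
    · simp only [zero_mul, mul_zero, zero_mem]
    · rw [add_mul, one_mul]
      omega
  subst hg
  have hc : uPath (ξ (G.r g₁)) * star (uPath ν₁) * x * uPath ν₂ * star (uPath (ξ (G.r g₁))) ∈
      Jv (G.r g₁) := by
    rw [← SetLike.mem_coe, h.corner _ ν₁ ν₂ hν₁ hν₂]
    exact ⟨x, hx, rfl⟩
  have hc' := hpi g₁ _ hc
  rw [piMap_corner hξ rfl rfl hν₁ hν₂, ← SetLike.mem_coe, h.corner _ μ₁ μ₂ hs₁.symm hs₂.symm] at hc'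
  obtain ⟨y, hy, hxy⟩ := hc'
  have k₁ : μ₁.src = (ξ (G.s g₁)).src := hs₁.symm.trans (hξ _).symm
  have k₂ : μ₂.src = (ξ (G.s g₁)).src := hs₂.symm.trans (hξ _).symm
  -- The entry has the same `(μ₁, μ₂)` corner as `y`; undoing the compression identifies it with
  -- `u_{μ₁} u_{μ₁}^* y u_{μ₂} u_{μ₂}^*`, an element of `J`.
  convert replace_mem hp rfl hJ hy (μ₁ := μ₁) (μ₂ := μ₂) rfl rfl using 1
  have h3 := congrArg (fun w => uPath μ₁ * star (uPath (ξ (G.s g₁))) * w *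
    (uPath (ξ (G.s g₁)) * star (uPath μ₂))) hxy
  simp only [mul_assoc, uPath_mul_cancel_assoc k₁, cancel_mul_star_uPath k₂] at h3
  simp only [mul_assoc]
  exact h3.symm

end CornerIdeals

end

end WeightedCK

end

open WeightedCK in
theorem mainTheorem11 {V E : Type*} [Fintype V] [Fintype E] (G : DirGraph V E)
    (hsinks : G.NoSinks) (hsources : G.NoSources)
    (W : WeightSequence G) (p : ℕ) (hp : 1 ≤ p) (hA : ConditionA W p)
    (ξ : V → G.Path (p - 1)) (hξ : ∀ v, (ξ v).src = v)
    (n : ℕ) (J : Submodule ℂ (LK G)) (hJ : IsIdealOf (C W p n : Set (LK G)) J) :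
    (∃! Jv : V → Submodule ℂ (LK G), IsCornerFamily W p n ξ J Jv) ∧
    ∀ Jv : V → Submodule ℂ (LK G), IsCornerFamily W p n ξ J Jv →
      (IsInvariant J ↔
        ∀ e f : E, G.r e = G.r f → G.s e = G.s f →
          ∀ c ∈ Jv (G.r e), piMap ξ e f c ∈ Jv (G.s e)) := by
  refine ⟨existsUnique_isCornerFamily hsinks hp hJ hξ, fun Jv h => ⟨?_, ?_⟩⟩
  · exact fun hinv e f hr hs c hc => piMap_mem_of_isInvariant hsinks hξ h hinv hr hs hc
  · exact fun hpi => isInvariant_of_piMap_mem hp hA hJ hξ h fun e => hpi e e rfl rfl
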